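/- Let $m\in\mathbb N$, and let $\mathcal G$ be a finite collection of colored chain posets $(i_1\prec\cdots\prec i_\ell)$, each of order $\ell\ge 2$, with colors $i_j\in\{1,\dots,m\}$; assume that $\mathcal G$ is sparse, i.e. for every color $c$ it contains a monochromatic chain $(c\prec\cdots\prec c)$ of some order. Let $\overline\beta=(\beta_1,\dots,\beta_m)\in(\mathbb R_{>0})^m$. A colored subset of $\mathcal P([n])$ is a subset $S\subset\mathcal P([n])$ with a coloring $c:S\to\{1,\dots,m\}$; it is valid if there are no $(i_1\prec\cdots\prec i_\ell)\in\mathcal G$ and $x_1\subsetneq\cdots\subsetneq x_\ell$ in $S$ with $c(x_j)=i_j$ for all $j$. A template is a function $T:\mathcal P([n])\to\mathcal P(\{1,\dots,m\})$; its support is $\{x: T(x)\ne\emptyset\}$, its size is $|T|=\sum_x|T(x)|$, and its weight is $\omega(\overline\beta,T)=\sum_{x\in\mathcal P([n])}\log\bigl(1+\sum_{i\in T(x)}\beta_i\bigr)$. It is valid if every coloring of its support that assigns to each $x$ an element of $T(x)$ is valid. A colored subset is contained in $T$ if the color of each of its elements $x$ lies in $T(x)$, and $T'$ is a sub-template of $T$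 if $T'(x)\subseteq T(x)$ for all $x$. Let $\omega_{crit}(\overline\beta)$ be the maximum of $\omega(\overline\beta,T)$ over all valid templates $T$ (on $\mathcal P([n])$, for any $n$) whose support is a chain. Then there is a constant $K>0$, depending only on $m$, $\mathcal G$ and $\overline\beta$, such that for every $\alpha\in(0,1)$ there exists $\epsilon>0$ such that the following holds. Let $n\in\mathbb N$, and let $T$ be a template on $\mathcal P([n])$ supported on sets of size between $\frac n3$ and $\frac{2n}3$ (inclusive) such that $\omega(\overline\beta,T)\ge(\omega_{crit}(\overline\beta)+\alpha)\binom{n}{\lfloor n/2\rfloor}$. Then there exists a family $\mathcal C$ of sub-templates of $T$ such that 1. for every validly colored subset $I$ contained in $T$ there is $T'\in\mathcal C$ such that $I$ is contained in $T'$; 2. $|\mathcal C|\le e^{K\frac{\log n}{n}|T|}$; 3. $|T'|\le(1-\epsilon)|T|$ for every $T'\in\mathcal C$. -/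

import Mathlib

namespace ColoredChains

/-- A colored subset of `𝒫([n])` with colors `Fin m`: a partial coloring, where `none` means that
the point is not in the subset and `some c` that it is in the subset with color `c`. -/
abbrev ColoredSubset (n m : ℕ) : Type := Finset (Fin n) → Option (Fin m)

/-- The colored chain poset `i₁ ≺ ⋯ ≺ i_ℓ`, written as the list `[i₁, …, i_ℓ]` of its colors from
bottom to top, appears as a colored subchain of `S`. -/
def ColoredSubset.HasSubchain {n m : ℕ} (S : ColoredSubset n m) (g : List (Fin m)) : Prop :=
  ∃ x : Fin g.length → Finset (Fin n), StrictMono x ∧ ∀ i, S (x i) = some (g.get i)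

/-- `S` is valid with respect to `𝒢`: no element of `𝒢` appears as a colored subchain of `S`. -/
def ColoredSubset.Valid {n m : ℕ} (𝒢 : Finset (List (Fin m))) (S : ColoredSubset n m) : Prop :=
  ∀ g ∈ 𝒢, ¬ S.HasSubchain g

/-- A template: a function `𝒫([n]) → 𝒫({1, …, m})`. Sub-templates are given by the pointwise
order `T' ≤ T`, that is `T' x ⊆ T x` for all `x`. -/
abbrev Template (n m : ℕ) : Type := Finset (Fin n) → Finset (Fin m)

/-- The support of a template. -/
def Template.supp {n m : ℕ} (T : Template n m) : Finset (Finset (Fin n)) :=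
  Finset.univ.filter fun x => (T x).Nonempty

/-- `S` is a coloring of (exactly) `Supp(T)` that gives each `x ∈ Supp(T)` an element of `T x`. -/
def Template.IsFullColoring {n m : ℕ} (T : Template n m) (S : ColoredSubset n m) : Prop :=
  (∀ x ∈ T.supp, ∃ c ∈ T x, S x = some c) ∧ ∀ x ∉ T.supp, S x = none

/-- A template is valid if each coloring of its support by allowed colors is valid. -/
def Template.Valid {n m : ℕ} (𝒢 : Finset (List (Fin m))) (T : Template n m) : Prop :=
  ∀ S : ColoredSubset n m, T.IsFullColoring S → S.Valid 𝒢

/-- The colored subset `S` is contained in the template `T`. -/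
def ColoredSubset.ContainedIn {n m : ℕ} (S : ColoredSubset n m) (T : Template n m) : Prop :=
  ∀ x c, S x = some c → c ∈ T x

/-- The size `|T|`: the number of pairs `(x, c)` with `c ∈ T x`. -/
def Template.size {n m : ℕ} (T : Template n m) : ℕ := ∑ x, (T x).card

/-- The weight `ω(β, T) = ∑ₓ log (1 + ∑_{i ∈ T x} βᵢ)`. -/
noncomputable def Template.weight {n m : ℕ} (β : Fin m → ℝ) (T : Template n m) : ℝ :=
  ∑ x, Real.log (1 + ∑ i ∈ T x, β i)

/-- `𝒢` is sparse: it forbids a monochromatic chain of every color. -/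
def Sparse {m : ℕ} (𝒢 : Finset (List (Fin m))) : Prop :=
  ∀ c : Fin m, ∃ ℓ : ℕ, List.replicate ℓ c ∈ 𝒢

/-- The weights of valid templates (on any `𝒫([n])`) whose support is a chain. -/
def chainWeights {m : ℕ} (𝒢 : Finset (List (Fin m))) (β : Fin m → ℝ) : Set ℝ :=
  {w | ∃ (n : ℕ) (T : Template n m), T.Valid 𝒢 ∧
    IsChain (· ⊆ ·) (T.supp : Set (Finset (Fin n))) ∧ w = T.weight β}

/-- The critical weight `ω_crit(β)`, the largest weight of a valid template supported on a chain.
For sparse `𝒢` the maximum exists, see `isGreatest_omegaCrit`. -/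
noncomputable def omegaCrit {m : ℕ} (𝒢 : Finset (List (Fin m))) (β : Fin m → ℝ) : ℝ :=
  sSup (chainWeights 𝒢 β)

theorem card_supp_le {m : ℕ} {𝒢 : Finset (List (Fin m))} (h𝒢 : Sparse 𝒢) {n : ℕ}
    {T : Template n m} (hT : T.Valid 𝒢)
    (hc : IsChain (· ⊆ ·) (T.supp : Set (Finset (Fin n)))) :
    T.supp.card ≤ m * 𝒢.sup List.length := by
  classical
  by_contra! hlt
  have hex : ∀ x ∈ T.supp, ∃ c, c ∈ T x := fun x hx => (Finset.mem_filter.1 hx).2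
  let S : ColoredSubset n m := fun x => if h : x ∈ T.supp then some (hex x h).choose else none
  have hS : T.IsFullColoring S :=
    ⟨fun x hx => ⟨_, (hex x hx).choose_spec, by simp [S, hx]⟩, fun x hx => by simp [S, hx]⟩
  obtain ⟨y, -, hy⟩ := Finset.exists_lt_card_fiber_of_mul_lt_card_of_maps_to
    (s := T.supp) (t := (Finset.univ : Finset (Fin m)).image some) (f := S)
    (n := 𝒢.sup List.length)
    (fun x hx => by simp [S, hx])
    (by rwa [Finset.card_image_of_injective _ (Option.some_injective _), Finset.card_univ,
      Fintype.card_fin])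
  obtain ⟨x₀, hx₀⟩ := Finset.card_pos.1 (lt_of_le_of_lt (Nat.zero_le _) hy)
  rw [Finset.mem_filter] at hx₀
  obtain ⟨c, -, hcx⟩ := hS.1 x₀ hx₀.1
  obtain ⟨ℓ, hℓ⟩ := h𝒢 c
  have hle : ℓ ≤ 𝒢.sup List.length := by
    simpa using Finset.le_sup (f := List.length) hℓ
  set A := T.supp.filter fun x => S x = y with hA
  have hinj : Set.InjOn Finset.card (A : Set (Finset (Fin n))) := by
    intro a ha b hb hab
    have ha' : a ∈ T.supp := (Finset.mem_filter.1 ha).1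
    have hb' : b ∈ T.supp := (Finset.mem_filter.1 hb).1
    rcases hc.total ha' hb' with h | h
    · exact Finset.eq_of_subset_of_card_le h hab.ge
    · exact (Finset.eq_of_subset_of_card_le h hab.le).symm
  have hcard : ℓ ≤ (A.image Finset.card).card := by
    rw [Finset.card_image_of_injOn hinj]; omega
  let e := Finset.orderEmbOfCardLe (A.image Finset.card) hcard
  have he : ∀ i, ∃ a ∈ A, a.card = e i := fun i =>
    Finset.mem_image.1 (Finset.orderEmbOfCardLe_mem _ hcard i)
  choose a haA hae using he
  refine hT S hS _ hℓ ⟨fun i => a (Fin.cast (by simp) i), ?_, ?_⟩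
  · intro i j hij
    have hlt' : (a (Fin.cast (by simp) i)).card < (a (Fin.cast (by simp) j)).card := by
      rw [hae, hae]; exact e.strictMono (by simpa using hij)
    rcases hc.total (Finset.mem_filter.1 (haA (Fin.cast (by simp) i))).1
      (Finset.mem_filter.1 (haA (Fin.cast (by simp) j))).1 with h | h
    · exact Finset.ssubset_iff_subset_ne.2 ⟨h, fun h' => hlt'.ne (congrArg Finset.card h')⟩
    · exact absurd (Finset.card_le_card h) (by omega)
  · intro i
    rw [(Finset.mem_filter.1 (haA _)).2, ← hx₀.2, hcx]
    simp

/-- For sparse `𝒢` the maximum in the definition of `ω_crit(β)` is attained. -/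
theorem isGreatest_omegaCrit {m : ℕ} {𝒢 : Finset (List (Fin m))} (h𝒢 : Sparse 𝒢)
    (h2 : ∀ g ∈ 𝒢, 2 ≤ g.length) (β : Fin m → ℝ) :
    IsGreatest (chainWeights 𝒢 β) (omegaCrit 𝒢 β) := by
  classical
  have hne : (chainWeights 𝒢 β).Nonempty := by
    refine ⟨_, 0, fun _ => ∅, ?_, ?_, rfl⟩
    · intro S hS g hg ⟨x, _, hx⟩
      have h0 := hS.2 (x ⟨0, by have := h2 g hg; omega⟩) (by simp [Template.supp])
      rw [hx] at h0
      simp at h0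
    · simp [Template.supp]
  have hfin : (chainWeights 𝒢 β).Finite := by
    let F : Multiset (Finset (Fin m)) → ℝ :=
      fun M => (M.map fun s => Real.log (1 + ∑ i ∈ s, β i)).sum
    refine Set.Finite.subset (Set.finite_iUnion (ι := Fin (m * 𝒢.sup List.length + 1))
      fun k => Set.finite_range fun M : Sym (Finset (Fin m)) k => F M.1) ?_
    rintro w ⟨n, T, hT, hc, rfl⟩
    refine Set.mem_iUnion.2 ⟨⟨_, Nat.lt_succ_of_le (card_supp_le h𝒢 hT hc)⟩,
      ⟨T.supp.val.map T, by simp⟩, ?_⟩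
    simp only [F, Multiset.map_map, Template.weight]
    refine Finset.sum_subset (Finset.subset_univ T.supp) fun x _ hx => ?_
    have : T x = ∅ := by simpa [Template.supp, Finset.not_nonempty_iff_eq_empty] using hx
    simp [this]
  exact ⟨hne.csSup_mem hfin, fun w hw => le_csSup hfin.bddAbove hw⟩

end ColoredChains

/-! Take the hypergraph whose vertices are the pairs `(x, c)` with `c ∈ T x` and whose edges are the
colored copies of members of `𝒢`. A validly colored subset contained in `T` is an independent set,
so the theorem is a hypergraph container statement. Two ingredients are needed.

Supersaturation (`exists_spread_weight`). On a maximal chain, pack bad edges fractionally until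
every bad edge has a saturated pair (`exists_saturating_packing`). Deleting the saturated pairs
leaves a valid template supported on a chain, of weight at most `omegaCrit`, so any excess weight is
paid for by the packing. Capacities proportional to the binomial coefficient of the layer make all
sets equally important when averaging over maximal chains. The averaged packing is a weight on bad
edges. Its total is at least a constant times `|T|`, and its degree at `X` is at most `(6 / n) ^
(|X| - 1)`, since few maximal chains pass through several given sets of the middle layers
(`card_commonPrefixed_le`).

Containers (`exists_containers`). With `p = 6 / n`, independent sets of such a spread weight are
covered by sets missing a fixed proportion of the vertices. Each is encoded by a bounded number of
fingerprints of size at most `p |T|`, hence the count `exp (K (log n / n) |T|)`. Each round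
(`container_step`) lowers the uniformity by one. The fingerprint of `I` is chosen by optimization:
it maximizes `F S - λ |S|` over `S ⊆ I`, where `F S` is the largest total weight of a degree-capped
weight dominated by the links of `S`.

For bounded `n` one bad edge is enough: every valid coloring omits one of its pairs. -/

namespace ColoredChains

open Finset

/-! ### Weighted hypergraphs, degrees and links. -/

section Containers

variable {α : Type*} [DecidableEq α]

/-- The total weight of the `k`-subsets of `V` that contain `X`. -/
def wdeg (V : Finset α) (k : ℕ) (w : Finset α → ℝ) (X : Finset α) : ℝ :=
  ∑ A ∈ (V.powersetCard k).filter (X ⊆ ·), w A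

/-- The weights `g` on `k`-sets which are dominated by the links in `w` of the vertices of `S` and
whose degrees are at most `cap`. -/
def linkWeights (V : Finset α) (k : ℕ) (w : Finset α → ℝ) (cap : ℕ → ℝ) (S : Finset α) :
    Set (Finset α → ℝ) :=
  {g | (∀ B ⊆ V, 0 ≤ g B ∧ g B ≤ ∑ v ∈ S \ B, w (insert v B)) ∧
    (∀ B, ¬ B ⊆ V → g B = 0) ∧ ∀ X, wdeg V k g X ≤ cap X.card}

theorem wdeg_nonneg {V : Finset α} {k : ℕ} {w : Finset α → ℝ} (hw : ∀ A ⊆ V, 0 ≤ w A)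
    (X : Finset α) : 0 ≤ wdeg V k w X :=
  sum_nonneg fun A hA => hw A (mem_powersetCard.1 (mem_filter.1 hA).1).1

theorem wdeg_empty (V : Finset α) (k : ℕ) (w : Finset α → ℝ) :
    wdeg V k w ∅ = ∑ A ∈ V.powersetCard k, w A := by
  simp [wdeg]

theorem wdeg_add (V : Finset α) (k : ℕ) (w w' : Finset α → ℝ) (X : Finset α) :
    wdeg V k (fun A => w A + w' A) X = wdeg V k w X + wdeg V k w' X := by
  simp [wdeg, sum_add_distrib]

/-- The degree of `X` in the link of `v`. -/
theorem wdeg_link (V : Finset α) (k : ℕ) (w : Finset α → ℝ) {v : α} (hv : v ∈ V) {X : Finset α}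
    (hX : v ∉ X) :
    wdeg V k (fun B => if v ∈ B then 0 else w (insert v B)) X = wdeg V (k + 1) w (insert v X) := by
  unfold wdeg
  rw [← sum_filter_of_ne (p := fun B => v ∉ B) (fun B _ h hvB => h (by simp [hvB]))]
  refine sum_bij' (fun B _ => insert v B) (fun A _ => A.erase v) ?_ ?_ ?_ ?_ ?_
  · intro B hB
    simp only [mem_filter, mem_powersetCard] at hB ⊢
    exact ⟨⟨insert_subset hv hB.1.1.1, by rw [card_insert_of_notMem hB.2, hB.1.1.2]⟩,
      insert_subset_insert _ hB.1.2⟩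
  · intro A hA
    simp only [mem_filter, mem_powersetCard] at hA ⊢
    have hvA : v ∈ A := hA.2 (mem_insert_self _ _)
    refine ⟨⟨⟨(erase_subset _ _).trans hA.1.1, by rw [card_erase_of_mem hvA, hA.1.2]; rfl⟩, ?_⟩,
      notMem_erase _ _⟩
    exact fun x hx => mem_erase.2 ⟨fun h => hX (h ▸ hx), hA.2 (mem_insert_of_mem hx)⟩
  · intro B hB
    exact erase_insert (mem_filter.1 hB).2
  · intro A hA
    exact insert_erase ((mem_filter.1 hA).2 (mem_insert_self _ _))
  · intro B hB
    simp [(mem_filter.1 hB).2]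

theorem sum_wdeg_singleton (V : Finset α) (k : ℕ) (w : Finset α → ℝ) :
    ∑ v ∈ V, wdeg V k w {v} = k * wdeg V k w ∅ := by
  unfold wdeg
  simp only [sum_filter, singleton_subset_iff, empty_subset, if_true]
  rw [sum_comm, mul_sum]
  refine sum_congr rfl fun A hA => ?_
  rw [mem_powersetCard] at hA
  rw [← sum_filter, filter_mem_eq_inter, inter_eq_right.2 hA.1, sum_const, hA.2, nsmul_eq_mul]

/-- This makes the maximum defining `F` in `container_step` attained. Forcing `g` to vanish off the
subsets of `V` bounds every coordinate, so the set is a closed part of a product of compact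
intervals and points. -/
theorem isCompact_linkWeights (V : Finset α) (k : ℕ) (w : Finset α → ℝ) (cap : ℕ → ℝ)
    (S : Finset α) : IsCompact (linkWeights V k w cap S) := by
  have h : linkWeights V k w cap S =
      (Set.univ.pi fun B => if B ⊆ V then Set.Icc 0 (∑ v ∈ S \ B, w (insert v B)) else {0}) ∩
        ⋂ X : Finset α, {g | wdeg V k g X ≤ cap X.card} := by
    ext g
    simp only [linkWeights, Set.mem_ofPred_eq, Set.mem_inter_iff, Set.mem_pi, Set.mem_univ,
      true_implies, Set.mem_iInter, ← and_assoc]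
    refine and_congr_left fun _ => ⟨fun h B => ?_, fun h => ⟨fun B hB => ?_, fun B hB => ?_⟩⟩
    · by_cases hB : B ⊆ V
      · simpa [hB] using h.1 B hB
      · simpa [hB] using h.2 B hB
    · simpa [hB] using h B
    · simpa [hB] using h B
  rw [h]
  refine (isCompact_univ_pi fun B => ?_).inter_right (isClosed_iInter fun X => ?_)
  · split_ifs
    exacts [isCompact_Icc, isCompact_singleton]
  · exact isClosed_le (by unfold wdeg; fun_prop) continuous_const

theorem zero_mem_linkWeights {V : Finset α} {k : ℕ} {w : Finset α → ℝ} {cap : ℕ → ℝ}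
    {S : Finset α} (hS : S ⊆ V) (hw : ∀ A ⊆ V, 0 ≤ w A) (hcap : ∀ j, 0 ≤ cap j) :
    (fun _ => 0) ∈ linkWeights V k w cap S := by
  refine ⟨fun B hB => ⟨le_rfl, sum_nonneg fun v hv => hw _ ?_⟩, fun _ _ => rfl, fun X => ?_⟩
  · exact insert_subset (hS (mem_sdiff.1 hv).1) hB
  · simpa [wdeg] using hcap _

/-- The edges of `w` that contain none of the nonempty sets whose `g`-degree exceeds half the
bound `cap`. -/
noncomputable def lightPart (V : Finset α) (k : ℕ) (w : Finset α → ℝ) (cap : ℕ → ℝ)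
    (g : Finset α → ℝ) (A : Finset α) : ℝ :=
  open Classical in
  if ∃ X ⊆ A, X.Nonempty ∧ cap X.card / 2 < wdeg V k g X then 0 else w A

theorem lightPart_le {V : Finset α} {k : ℕ} {w : Finset α → ℝ} (hw : ∀ A ⊆ V, 0 ≤ w A)
    (cap : ℕ → ℝ) (g : Finset α → ℝ) {A : Finset α} (hA : A ⊆ V) :
    0 ≤ lightPart V k w cap g A ∧ lightPart V k w cap g A ≤ w A := by
  unfold lightPart
  split_ifs
  exacts [⟨le_rfl, hw A hA⟩, ⟨hw A hA, le_rfl⟩]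

/-- The light part of the link of a new vertex can be added to `g`. -/
theorem add_link_mem_linkWeights {V : Finset α} {k : ℕ} {w : Finset α → ℝ} {cap : ℕ → ℝ}
    {S : Finset α} (hw : ∀ A ⊆ V, 0 ≤ w A) (hcap : ∀ j, 0 ≤ cap j)
    {g : Finset α → ℝ} (hg : g ∈ linkWeights V k w cap S) (hg0 : wdeg V k g ∅ ≤ cap 0 / 2)
    (hdeg : ∀ X : Finset α, X.Nonempty → wdeg V (k + 1) w X ≤ cap (X.card - 1) / 2)
    {v : α} (hv : v ∈ V) (hvS : v ∉ S) :
    (fun B => g B + if B ⊆ V then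
      (if v ∈ B then 0 else lightPart V k w cap g (insert v B)) else 0) ∈
      linkWeights V k w cap (insert v S) := by
  refine ⟨fun B hB => ?_, fun B hB => by simp [hB, hg.2.1 B hB], fun X => ?_⟩
  · have hl := lightPart_le (k := k) hw cap g (insert_subset hv hB)
    simp only [if_pos hB]
    by_cases hvB : v ∈ B
    · rw [if_pos hvB, add_zero, insert_sdiff_of_mem _ hvB]
      exact hg.1 B hB
    · rw [if_neg hvB, insert_sdiff_of_notMem _ hvB, sum_insert (by simp [hvS])]
      have := hg.1 B hB
      constructor <;> linarith
  · rw [wdeg_add]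
    have hlink : wdeg V k (fun B => if B ⊆ V then
        (if v ∈ B then 0 else lightPart V k w cap g (insert v B)) else 0) X =
        wdeg V k (fun B => if v ∈ B then 0 else lightPart V k w cap g (insert v B)) X := by
      refine sum_congr rfl fun B hB => if_pos (mem_powersetCard.1 (mem_filter.1 hB).1).1
    rw [hlink]
    have hcX := hcap X.card
    by_cases hvX : v ∈ X
    · have : wdeg V k (fun B => if v ∈ B then 0 else lightPart V k w cap g (insert v B)) X = 0 :=
        sum_eq_zero fun B hB => if_pos ((mem_filter.1 hB).2 hvX)
      rw [this, add_zero]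
      exact hg.2.2 X
    -- A heavy `X` receives nothing from the light part. Otherwise the old degree and the link
    -- degree are each at most half of the cap.
    by_cases hheavy : X.Nonempty ∧ cap X.card / 2 < wdeg V k g X
    · have : wdeg V k (fun B => if v ∈ B then 0 else lightPart V k w cap g (insert v B)) X = 0 := by
        refine sum_eq_zero fun B hB => ?_
        have : ∃ Y ⊆ insert v B, Y.Nonempty ∧ cap Y.card / 2 < wdeg V k g Y :=
          ⟨X, (mem_filter.1 hB).2.trans (subset_insert _ _), hheavy⟩
        simp only [lightPart, if_pos this, ite_self]
      rw [this, add_zero]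
      exact hg.2.2 X
    · have h1 : wdeg V k g X ≤ cap X.card / 2 := by
        rcases X.eq_empty_or_nonempty with rfl | hX
        · exact hg0
        · exact not_lt.1 fun h => hheavy ⟨hX, h⟩
      rw [wdeg_link V k _ hv hvX]
      have h2 : wdeg V (k + 1) (lightPart V k w cap g) (insert v X) ≤
          wdeg V (k + 1) w (insert v X) := by
        refine sum_le_sum fun A hA => (lightPart_le hw cap g ?_).2
        exact (mem_powersetCard.1 (mem_filter.1 hA).1).1
      have h3 := hdeg (insert v X) (insert_nonempty _ _)
      rw [card_insert_of_notMem hvX, Nat.add_sub_cancel] at h3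
      linarith

/-- The edges that are not light have small total weight. -/
theorem sum_sub_lightPart_le {V : Finset α} {k : ℕ} {w : Finset α → ℝ} {cap : ℕ → ℝ}
    (hw : ∀ A ⊆ V, 0 ≤ w A) {g : Finset α → ℝ} (hg : ∀ A ⊆ V, 0 ≤ g A)
    {p : ℝ} (hp : 0 < p)
    (hdeg : ∀ X : Finset α, X.Nonempty → p * wdeg V (k + 1) w X ≤ cap X.card / 2) :
    p * (wdeg V (k + 1) w ∅ - wdeg V (k + 1) (lightPart V k w cap g) ∅) ≤
      2 ^ k * wdeg V k g ∅ := by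
  classical
  set 𝓗 := V.powerset.filter fun X => X.Nonempty ∧ cap X.card / 2 < wdeg V k g X with h𝓗
  -- Every discarded edge contains a heavy set, so a union bound over the heavy sets applies.
  have h1 : wdeg V (k + 1) w ∅ - wdeg V (k + 1) (lightPart V k w cap g) ∅ ≤
      ∑ X ∈ 𝓗, wdeg V (k + 1) w X := by
    rw [wdeg_empty, wdeg_empty, ← sum_sub_distrib]
    simp only [wdeg, sum_filter]
    rw [sum_comm]
    refine sum_le_sum fun A hA => ?_
    have hAV := (mem_powersetCard.1 hA).1
    have hnn : ∀ X ∈ 𝓗, 0 ≤ if X ⊆ A then w A else 0 := fun X _ => by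
      split_ifs
      exacts [hw A hAV, le_rfl]
    by_cases h : ∃ X ⊆ A, X.Nonempty ∧ cap X.card / 2 < wdeg V k g X
    · obtain ⟨X, hXA, hX⟩ := h
      have hXH : X ∈ 𝓗 := mem_filter.2 ⟨mem_powerset.2 (hXA.trans hAV), hX⟩
      have := single_le_sum hnn hXH
      rw [if_pos hXA] at this
      have := (lightPart_le (k := k) hw cap g hAV).1
      linarith
    · rw [lightPart, if_neg h, sub_self]
      exact sum_nonneg hnn
  -- Each `k`-set is counted once for each of its `2 ^ k` subsets.
  have h2 : ∑ X ∈ V.powerset, wdeg V k g X = 2 ^ k * wdeg V k g ∅ := by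
    rw [wdeg_empty, mul_sum]
    simp only [wdeg, sum_filter]
    rw [sum_comm]
    refine sum_congr rfl fun A hA => ?_
    obtain ⟨hAV, hAk⟩ := mem_powersetCard.1 hA
    rw [← sum_filter, sum_const, nsmul_eq_mul]
    congr 1
    have : V.powerset.filter (· ⊆ A) = A.powerset := by
      ext X
      simp only [mem_filter, mem_powerset]
      exact ⟨fun h => h.2, fun h => ⟨h.trans hAV, h⟩⟩
    rw [this, card_powerset, hAk]
    norm_cast
  calc _ ≤ p * ∑ X ∈ 𝓗, wdeg V (k + 1) w X := mul_le_mul_of_nonneg_left h1 hp.le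
    _ = ∑ X ∈ 𝓗, p * wdeg V (k + 1) w X := mul_sum _ _ _
    _ ≤ ∑ X ∈ 𝓗, wdeg V k g X := sum_le_sum fun X hX =>
        (hdeg X (mem_filter.1 hX).2.1).trans (mem_filter.1 hX).2.2.le
    _ ≤ ∑ X ∈ V.powerset, wdeg V k g X :=
        sum_le_sum_of_subset_of_nonneg (filter_subset _ _) fun X _ _ => wdeg_nonneg hg X
    _ = _ := h2

/-- If the vertices outside `C` have large total light degree, then `C` is not too large. -/
theorem card_le_of_sum_wdeg {V C : Finset α} (hC : C ⊆ V) {k : ℕ} {w : Finset α → ℝ} {D s : ℝ}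
    (hD : ∀ v ∈ V, wdeg V k w {v} ≤ D) (hs : s ≤ ∑ v ∈ V \ C, wdeg V k w {v}) :
    s ≤ D * (V.card - C.card) := by
  refine hs.trans ((sum_le_card_nsmul _ _ D fun v hv => hD v (mem_sdiff.1 hv).1).trans ?_)
  rw [nsmul_eq_mul, card_sdiff_of_subset hC, Nat.cast_sub (card_le_card hC), mul_comm]

end Containers

/-- One round of the container algorithm: for each fingerprint `S` we get a container `C S` which
is either small or comes with a spread weight of lower uniformity. -/
theorem container_step {α : Type*} [DecidableEq α] {V : Finset α} {k : ℕ} {w : Finset α → ℝ}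
    {K p : ℝ} (hK : 1 ≤ K) (hp : 0 < p) (hp1 : p ≤ 1)
    (hM : 2 ^ (k + 5) * K ^ 2 ≤ p * V.card) (hw : ∀ A ⊆ V, 0 ≤ w A)
    (hW : 0 < wdeg V (k + 1) w ∅)
    (hdeg : ∀ X : Finset α, X.Nonempty →
      wdeg V (k + 1) w X * V.card ≤ K * p ^ (X.card - 1) * wdeg V (k + 1) w ∅) :
    ∃ (𝒮 : Finset (Finset α)) (C : Finset α → Finset α),
      𝒮 ⊆ V.powerset.filter (fun S => (S.card : ℝ) ≤ p * V.card) ∧ (∀ S, C S ⊆ V) ∧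
      (∀ I ⊆ V, ∃ S ∈ 𝒮, S ⊆ I ∧ I ⊆ C S) ∧
      ∀ S ∈ 𝒮, ((C S).card : ℝ) ≤ (1 - 1 / (2 * K)) * V.card ∨
        ∃ g : Finset α → ℝ, (∀ B ⊆ V, 0 ≤ g B ∧ g B ≤ ∑ v ∈ S \ B, w (insert v B)) ∧
          0 < wdeg V k g ∅ ∧ ∀ X : Finset α, X.Nonempty →
            wdeg V k g X * V.card ≤ (2 ^ (k + 6) * K ^ 2) * p ^ (X.card - 1) * wdeg V k g ∅ := by
  classical
  set W := wdeg V (k + 1) w ∅ with hWdef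
  have hK0 : 0 < K := by linarith
  have hN : (0 : ℝ) < V.card := by
    have : 0 < p * V.card := lt_of_lt_of_le (by positivity) hM
    exact pos_of_mul_pos_right this hp.le
  set N : ℝ := (V.card : ℝ) with hNdef
  set c : ℝ := 1 / (2 ^ (k + 4) * K) with hc
  have hc0 : 0 < c := by positivity
  have hcK : 2 ^ k * (c * K) = 1 / 16 := by rw [hc]; field_simp; ring
  have h2k : (1 : ℝ) ≤ 2 ^ k := one_le_pow₀ (by norm_num)
  have hcK' : c * K ≤ 1 / 16 := by nlinarith [mul_pos hc0 hK0]
  have hc16 : 2 ^ k * c ≤ 1 / 16 := by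
    rw [← hcK]
    exact mul_le_mul_of_nonneg_left (by nlinarith) (by positivity)
  -- For `j ≥ 1` the cap is twice what the degrees of `w` allow, which leaves room to add one more
  -- link. The cap at `0` bounds the total, hence the fingerprint size; `hM` ensures that a single
  -- vertex link fits into half of it.
  set cap : ℕ → ℝ := fun j => if j = 0 then c * p * W else 2 * K * p ^ j * W / N with hcapdef
  have hcap : ∀ j, 0 ≤ cap j := fun j => by
    simp only [hcapdef]
    split_ifs <;> positivity
  have hcap0 : cap 0 = c * p * W := by simp [hcapdef]
  have hcapn : ∀ j, j ≠ 0 → cap j = 2 * K * p ^ j * W / N := fun j hj => by simp [hcapdef, hj]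
  have hdeg1 : ∀ X : Finset α, X.Nonempty → wdeg V (k + 1) w X ≤ cap (X.card - 1) / 2 := by
    intro X hX
    have h1 := hdeg X hX
    rw [← le_div_iff₀ hN] at h1
    refine h1.trans ?_
    by_cases hX1 : X.card - 1 = 0
    · rw [hX1, hcap0, pow_zero, mul_one, div_le_iff₀ hN]
      have h2 : c * (2 ^ (k + 5) * K ^ 2) = 2 * K := by rw [hc]; field_simp; ring
      have h3 : 2 * K ≤ c * (p * N) := h2 ▸ mul_le_mul_of_nonneg_left hM hc0.le
      nlinarith
    · rw [hcapn _ hX1]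
      apply le_of_eq
      ring
  have hdeg2 : ∀ X : Finset α, X.Nonempty → p * wdeg V (k + 1) w X ≤ cap X.card / 2 := by
    intro X hX
    have h1 := hdeg X hX
    rw [← le_div_iff₀ hN] at h1
    have hX1 : X.card ≠ 0 := hX.card_pos.ne'
    have h2 : p ^ X.card = p * p ^ (X.card - 1) := (mul_pow_sub_one hX1 p).symm
    rw [hcapn _ hX1, h2]
    calc p * wdeg V (k + 1) w X ≤ p * (K * p ^ (X.card - 1) * W / N) :=
          mul_le_mul_of_nonneg_left h1 hp.le
      _ = _ := by ring
  have hmax : ∀ S, ∃ g, S ⊆ V → g ∈ linkWeights V k w cap S ∧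
      ∀ g' ∈ linkWeights V k w cap S, wdeg V k g' ∅ ≤ wdeg V k g ∅ := by
    intro S
    by_cases hS : S ⊆ V
    · obtain ⟨g, hg, hgm⟩ := (isCompact_linkWeights V k w cap S).exists_isMaxOn
        ⟨_, zero_mem_linkWeights hS hw hcap⟩
        (f := fun g => wdeg V k g ∅) (by unfold wdeg; fun_prop)
      exact ⟨g, fun _ => ⟨hg, fun g' hg' => hgm hg'⟩⟩
    · exact ⟨fun _ => 0, fun h => absurd h hS⟩
  choose g hg using hmax
  set F : Finset α → ℝ := fun S => wdeg V k (g S) ∅ with hF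
  set lam : ℝ := W / (4 * N) with hlam
  have hlam0 : 0 < lam := by positivity
  have hF0 : ∀ S ⊆ V, 0 ≤ F S := fun S hS => wdeg_nonneg (fun A hA => ((hg S hS).1.1 A hA).1) _
  have hFcap : ∀ S ⊆ V, F S ≤ c * p * W := fun S hS => by
    simpa [hcap0] using (hg S hS).1.2.2 ∅
  set C : Finset α → Finset α := fun S => V.filter fun v => F (insert v S) - F S ≤ lam with hC
  have hFS : ∀ S, lam * S.card ≤ F S → (S.card : ℝ) ≤ 4 * N / W * F S := fun S h => by
    rw [hlam] at h
    rw [div_mul_eq_mul_div, le_div_iff₀ hW]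
    rw [div_mul_eq_mul_div, div_le_iff₀ (by positivity)] at h
    linarith
  refine ⟨V.powerset.filter fun S => lam * S.card ≤ F S, C, ?_, fun S => filter_subset _ _, ?_, ?_⟩
  · intro S hS
    rw [mem_filter, mem_powerset] at hS ⊢
    refine ⟨hS.1, (hFS S hS.2).trans ?_⟩
    calc 4 * N / W * F S ≤ 4 * N / W * (c * p * W) :=
          mul_le_mul_of_nonneg_left (hFcap S hS.1) (by positivity)
      _ = (4 * c) * (p * N) := by field_simp
      _ ≤ 1 * (p * N) := by
          refine mul_le_mul_of_nonneg_right ?_ (by positivity)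
          nlinarith
      _ = p * N := one_mul _
  · intro I hI
    obtain ⟨S, hS, hSmax⟩ := exists_max_image I.powerset (fun S => F S - lam * S.card)
      ⟨∅, empty_mem_powerset I⟩
    rw [mem_powerset] at hS
    refine ⟨S, ?_, hS, ?_⟩
    · rw [mem_filter, mem_powerset]
      refine ⟨hS.trans hI, ?_⟩
      have h1 := hSmax ∅ (empty_mem_powerset I)
      have h2 := hF0 ∅ (empty_subset V)
      simp only [card_empty, Nat.cast_zero, mul_zero, sub_zero] at h1
      linarith
    · intro v hv
      refine mem_filter.2 ⟨hI hv, ?_⟩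
      by_cases hvS : v ∈ S
      · rw [insert_eq_of_mem hvS, sub_self]
        exact hlam0.le
      · have := hSmax (insert v S) (mem_powerset.2 (insert_subset hv hS))
        simp only [card_insert_of_notMem hvS, Nat.cast_add, Nat.cast_one] at this
        linarith
  · intro S hS
    rw [mem_filter, mem_powerset] at hS
    obtain ⟨hSV, hSF⟩ := hS
    obtain ⟨hgS, hgmax⟩ := hg S hSV
    -- If the total is at most half its cap, the light link of any new vertex can still be added, so
    -- vertices of `C S` outside `S` have light degree at most `lam`. Otherwise `g S` is heavy
    -- enough to be spread itself.
    rcases le_or_gt (F S) (c * p * W / 2) with hcase | hcase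
    · left
      set l := lightPart V k w cap (g S) with hl
      have hlnn : ∀ A ⊆ V, 0 ≤ l A := fun A hA => (lightPart_le hw cap (g S) hA).1
      have hlw : ∀ X, wdeg V (k + 1) l X ≤ wdeg V (k + 1) w X := fun X =>
        sum_le_sum fun A hA =>
          (lightPart_le hw cap (g S) (mem_powersetCard.1 (mem_filter.1 hA).1).1).2
      have hD : ∀ v ∈ V, wdeg V (k + 1) l {v} ≤ K * W / N := fun v _ => by
        refine (hlw _).trans ?_
        rw [le_div_iff₀ hN]
        simpa using hdeg {v} (singleton_nonempty v)
      have hgain : ∀ v ∈ V, v ∉ S → wdeg V (k + 1) l {v} ≤ F (insert v S) - F S := by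
        intro v hv hvS
        have h1 := add_link_mem_linkWeights hw hcap hgS (by rw [hcap0]; exact hcase) hdeg1 hv
          hvS
        have h2 := (hg (insert v S) (insert_subset hv hSV)).2 _ h1
        rw [wdeg_add] at h2
        have h3 : wdeg V k (fun B => if B ⊆ V then
            (if v ∈ B then 0 else lightPart V k w cap (g S) (insert v B)) else 0) ∅ =
            wdeg V (k + 1) l {v} := by
          rw [← insert_empty_eq v, ← wdeg_link V k l hv (notMem_empty v)]
          exact sum_congr rfl fun B hB => if_pos (mem_powersetCard.1 (mem_filter.1 hB).1).1
        rw [h3] at h2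
        simp only [hF]
        linarith
      have hrem : wdeg V (k + 1) w ∅ - wdeg V (k + 1) l ∅ ≤ W / 32 := by
        have h1 := sum_sub_lightPart_le (cap := cap) hw (fun A hA => (hgS.1 A hA).1) hp hdeg2
        have h2 : 2 ^ k * wdeg V k (g S) ∅ ≤ 2 ^ k * (c * p * W / 2) :=
          mul_le_mul_of_nonneg_left hcase (by positivity)
        have h3 : 2 ^ k * (c * p * W / 2) ≤ p * (W / 32) := by
          have := mul_le_mul_of_nonneg_right hc16 (mul_pos hp hW).le
          nlinarith
        exact le_of_mul_le_mul_left (h1.trans (h2.trans h3)) hp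
      have htot : W * (31 / 32) ≤ ∑ v ∈ V, wdeg V (k + 1) l {v} := by
        rw [sum_wdeg_singleton]
        have h1 : (1 : ℝ) ≤ ((k + 1 : ℕ) : ℝ) := by exact_mod_cast Nat.succ_pos k
        have h2 := wdeg_nonneg (k := k + 1) hlnn ∅
        nlinarith
      have hCV : C S ⊆ V := filter_subset _ _
      have hsumS : ∑ v ∈ S, wdeg V (k + 1) l {v} ≤ W / 8 := by
        refine (sum_le_card_nsmul _ _ (K * W / N) fun v hv => hD v (hSV hv)).trans ?_
        rw [nsmul_eq_mul]
        calc (S.card : ℝ) * (K * W / N) ≤ (4 * N / W * (c * p * W / 2)) * (K * W / N) :=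
              mul_le_mul_of_nonneg_right ((hFS S hSF).trans
                (mul_le_mul_of_nonneg_left hcase (by positivity))) (by positivity)
          _ = 2 * (c * K) * p * W := by field_simp; ring
          _ ≤ W / 8 := by
              have : c * K * p ≤ 1 / 16 := by nlinarith [mul_pos hc0 hK0]
              nlinarith
      have hsumC : ∑ v ∈ C S \ S, wdeg V (k + 1) l {v} ≤ W / 4 := by
        refine (sum_le_card_nsmul _ _ lam fun v hv => ?_).trans ?_
        · rw [mem_sdiff] at hv
          have hv' := mem_filter.1 hv.1
          exact (hgain v hv'.1 hv.2).trans hv'.2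
        · rw [nsmul_eq_mul]
          have h1 : ((C S \ S).card : ℝ) ≤ N := by
            rw [hNdef]
            exact_mod_cast card_le_card (sdiff_subset.trans hCV)
          calc ((C S \ S).card : ℝ) * lam ≤ N * lam := mul_le_mul_of_nonneg_right h1 hlam0.le
            _ = W / 4 := by rw [hlam]; field_simp
      have hsplit : ∑ v ∈ V, wdeg V (k + 1) l {v} ≤ ∑ v ∈ V \ C S, wdeg V (k + 1) l {v} +
          (∑ v ∈ C S \ S, wdeg V (k + 1) l {v} + ∑ v ∈ S, wdeg V (k + 1) l {v}) := by
        have hnn : ∀ v, 0 ≤ wdeg V (k + 1) l {v} := fun v => wdeg_nonneg hlnn _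
        rw [← sum_sdiff hCV]
        refine add_le_add_right ?_ _
        rw [← sum_union sdiff_disjoint]
        exact sum_le_sum_of_subset_of_nonneg (by intro v hv; simp [hv]) fun v _ _ => hnn v
      -- The light degree left outside `C S` is at least `(31/32 - 1/4 - 1/8) W ≥ W / 2`.
      have := card_le_of_sum_wdeg hCV hD (s := W / 2) (by linarith)
      rw [← hNdef, div_mul_eq_mul_div, le_div_iff₀ hN] at this
      have h4 : N ≤ 2 * K * (N - (C S).card) := by nlinarith
      have h5 : (1 - 1 / (2 * K)) * N = N - N / (2 * K) := by ring
      rw [h5, le_sub_comm, div_le_iff₀ (by positivity)]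
      linarith
    · right
      refine ⟨g S, hgS.1, lt_of_le_of_lt (by positivity) hcase, fun X hX => ?_⟩
      have h1 := hgS.2.2 X
      have hX1 : X.card ≠ 0 := hX.card_pos.ne'
      have h2 : p ^ X.card = p * p ^ (X.card - 1) := (mul_pow_sub_one hX1 p).symm
      rw [hcapn _ hX1, le_div_iff₀ hN] at h1
      refine h1.trans ?_
      have h3 : 2 ^ (k + 6) * K ^ 2 * c = 4 * K := by rw [hc]; field_simp; ring
      calc 2 * K * p ^ X.card * W = (2 ^ (k + 6) * K ^ 2 * c) * p ^ (X.card - 1) * (p * W / 2) := by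
            rw [h3, h2]; ring
        _ = (2 ^ (k + 6) * K ^ 2) * p ^ (X.card - 1) * (c * p * W / 2) := by ring
        _ ≤ _ := mul_le_mul_of_nonneg_left hcase.le (by positivity)

/-- A weighted hypergraph container theorem. The independent sets of a spread `k + 1`-uniform
hypergraph are covered by few containers, each missing a positive proportion of the vertices. -/
theorem exists_containers (k : ℕ) : ∀ K : ℝ, 1 ≤ K → ∃ δ : ℝ, 0 < δ ∧ ∃ M : ℝ,
    ∀ (α : Type) [DecidableEq α] (V : Finset α) (p : ℝ) (w : Finset α → ℝ),
      0 < p → p ≤ 1 → M ≤ p * V.card → (∀ A ⊆ V, 0 ≤ w A) → 0 < wdeg V (k + 1) w ∅ →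
      (∀ X : Finset α, X.Nonempty →
        wdeg V (k + 1) w X * V.card ≤ K * p ^ (X.card - 1) * wdeg V (k + 1) w ∅) →
      ∃ 𝒞 : Finset (Finset α),
        𝒞.card ≤ (V.powerset.filter fun S => (S.card : ℝ) ≤ p * V.card).card ^ k ∧
        (∀ C ∈ 𝒞, C ⊆ V ∧ (C.card : ℝ) ≤ (1 - δ) * V.card) ∧
        ∀ I ⊆ V, (∀ A ⊆ I, w A = 0) → ∃ C ∈ 𝒞, I ⊆ C := by
  induction k with
  | zero =>
    intro K hK
    refine ⟨1 / K, by positivity, 0, fun α _ V p w hp hp1 hM hw hW hdeg => ?_⟩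
    -- In uniformity one, independent sets avoid all vertices of positive weight, so a single
    -- container is enough.
    refine ⟨{V.filter fun v => wdeg V 1 w {v} = 0}, by simp, ?_, ?_⟩
    · simp only [mem_singleton, forall_eq]
      have hCV := filter_subset (fun v => wdeg V 1 w {v} = 0) V
      refine ⟨hCV, ?_⟩
      have hN : (0 : ℝ) < V.card := by
        rcases V.eq_empty_or_nonempty with rfl | hV
        · rw [wdeg_empty, powersetCard_eq_empty.2 (by simp)] at hW
          simp at hW
        · exact_mod_cast hV.card_pos
      have h1 := card_le_of_sum_wdeg hCV (k := 1) (w := w)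
        (D := K * wdeg V 1 w ∅ / V.card) (s := wdeg V 1 w ∅) (fun v _ => by
          rw [le_div_iff₀ hN]
          simpa using hdeg {v} (singleton_nonempty v)) (by
          have h2 := sum_wdeg_singleton V 1 w
          rw [Nat.cast_one, one_mul, ← sum_sdiff hCV,
            sum_eq_zero (s := V.filter _) fun v hv => (mem_filter.1 hv).2, add_zero] at h2
          exact h2.ge)
      rw [div_mul_eq_mul_div, le_div_iff₀ hN] at h1
      have h3 : (V.card : ℝ) ≤ K * (V.card - (V.filter fun v => wdeg V 1 w {v} = 0).card) := by
        simp only [zero_add] at hW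
        refine le_of_mul_le_mul_left (h1.trans_eq ?_) hW
        ring
      have h5 : (1 - 1 / K) * (V.card : ℝ) = V.card - V.card / K := by ring
      rw [h5, le_sub_comm, div_le_iff₀ (by positivity)]
      linarith
    · intro I hI hind
      refine ⟨_, mem_singleton_self _, fun v hv => mem_filter.2 ⟨hI hv, sum_eq_zero fun A hA => ?_⟩⟩
      rw [mem_filter, mem_powersetCard, singleton_subset_iff] at hA
      obtain ⟨u, rfl⟩ := card_eq_one.1 hA.1.2
      rw [mem_singleton] at hA
      exact hind _ (by rw [← hA.2]; simpa using hv)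
  | succ k ih =>
    intro K hK
    obtain ⟨δ, hδ, M, hind⟩ := ih (2 ^ (k + 1 + 6) * K ^ 2) (by
      have h1 : (1 : ℝ) ≤ 2 ^ (k + 1 + 6) := one_le_pow₀ (by norm_num)
      have h2 : (1 : ℝ) ≤ K ^ 2 := one_le_pow₀ hK
      nlinarith)
    refine ⟨min δ (1 / (2 * K)), by positivity, max M (2 ^ (k + 1 + 5) * K ^ 2),
      fun α _ V p w hp hp1 hM hw hW hdeg => ?_⟩
    obtain ⟨𝒮, C, h𝒮, hCV, hfp, hC⟩ := container_step hK hp hp1 ((le_max_right _ _).trans hM) hw hW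
      hdeg
    set 𝓟 := V.powerset.filter fun S => (S.card : ℝ) ≤ p * V.card with h𝓟
    have h𝓟1 : 1 ≤ 𝓟.card := card_pos.2 ⟨∅, by simp [h𝓟]; positivity⟩
    have hfam : ∀ S ∈ 𝒮, ∃ 𝒞 : Finset (Finset α), 𝒞.card ≤ 𝓟.card ^ k ∧
        (∀ D ∈ 𝒞, D ⊆ V ∧ (D.card : ℝ) ≤ (1 - min δ (1 / (2 * K))) * V.card) ∧
        ∀ I ⊆ V, S ⊆ I → I ⊆ C S → (∀ A ⊆ I, w A = 0) → ∃ D ∈ 𝒞, I ⊆ D := by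
      intro S hS
      have hSV : S ⊆ V := mem_powerset.1 (mem_filter.1 (h𝒮 hS)).1
      rcases hC S hS with hsmall | ⟨g, hg, hg0, hgdeg⟩
      · refine ⟨{C S}, by rw [card_singleton]; exact Nat.one_le_pow _ _ h𝓟1, ?_, ?_⟩
        · simp only [mem_singleton, forall_eq]
          refine ⟨hCV S, hsmall.trans (mul_le_mul_of_nonneg_right ?_ (Nat.cast_nonneg _))⟩
          linarith [min_le_right δ (1 / (2 * K))]
        · exact fun I _ _ hI _ => ⟨_, mem_singleton_self _, hI⟩
      · obtain ⟨𝒞, h1, h2, h3⟩ := hind α V p g hp hp1 ((le_max_left _ _).trans hM)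
          (fun A hA => (hg A hA).1) hg0 hgdeg
        refine ⟨𝒞, h1, fun D hD => ⟨(h2 D hD).1, (h2 D hD).2.trans ?_⟩, fun I hI hSI _ hw0 => ?_⟩
        · refine mul_le_mul_of_nonneg_right ?_ (Nat.cast_nonneg _)
          linarith [min_le_left δ (1 / (2 * K))]
        -- Independence passes from `w` to `g`: for `S ⊆ I` and `B ⊆ I`, each `insert v B` bounding
        -- `g B` also lies in `I`.
        · refine h3 I hI fun B hB => le_antisymm ?_ (hg B (hB.trans hI)).1
          refine (hg B (hB.trans hI)).2.trans (sum_eq_zero fun v hv => ?_).le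
          exact hw0 _ (insert_subset (hSI (mem_sdiff.1 hv).1) hB)
    choose! 𝒞 h𝒞 using hfam
    refine ⟨𝒮.biUnion 𝒞, ?_, ?_, ?_⟩
    · calc (𝒮.biUnion 𝒞).card ≤ 𝒮.card * 𝓟.card ^ k :=
            card_biUnion_le_card_mul _ _ _ fun S hS => (h𝒞 S hS).1
        _ ≤ 𝓟.card * 𝓟.card ^ k := Nat.mul_le_mul_right _ (card_le_card h𝒮)
        _ = 𝓟.card ^ (k + 1) := (pow_succ' _ _).symm
    · intro D hD
      obtain ⟨S, hS, hDS⟩ := mem_biUnion.1 hD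
      exact (h𝒞 S hS).2.1 D hDS
    · intro I hI hind
      obtain ⟨S, hS, hSI, hIC⟩ := hfp I hI
      obtain ⟨D, hD, hID⟩ := (h𝒞 S hS).2.2 I hI hSI hIC hind
      exact ⟨D, mem_biUnion.2 ⟨S, hS, hD⟩, hID⟩

/-! ### Greedy fractional packings. -/

/-- Every finite hypergraph with vertex capacities has a fractional packing for which each edge
contains a saturated vertex. -/
theorem exists_saturating_packing {ι : Type*} [DecidableEq ι] (E : Finset (Finset ι))
    (hE : ∀ A ∈ E, A.Nonempty) (z : ι → ℝ) (hz : ∀ v, 0 ≤ z v) :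
    ∃ y : Finset ι → ℝ, (∀ A, 0 ≤ y A) ∧ (∀ A ∉ E, y A = 0) ∧
      (∀ v, ∑ A ∈ E, (if v ∈ A then y A else 0) ≤ z v) ∧
      ∀ A ∈ E, ∃ v ∈ A, ∑ B ∈ E, (if v ∈ B then y B else 0) = z v := by
  induction E using Finset.induction_on with
  | empty => exact ⟨fun _ => 0, by simp, by simp, by simpa using hz, by simp⟩
  | insert A E hA ih =>
    obtain ⟨y, h0, hout, hle, hsat⟩ := ih fun B hB => hE B (mem_insert_of_mem hB)
    set d : ι → ℝ := fun v => ∑ B ∈ E, if v ∈ B then y B else 0 with hd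
    -- The new edge gets the smallest residual capacity among its vertices, which saturates `u`.
    obtain ⟨u, hu, humin⟩ := exists_min_image A (fun v => z v - d v) (hE A (mem_insert_self _ _))
    set y' := Function.update y A (z u - d u) with hy'
    have hsum : ∀ v, ∑ B ∈ insert A E, (if v ∈ B then y' B else 0) =
        (if v ∈ A then z u - d u else 0) + d v := by
      intro v
      rw [sum_insert hA]
      congr 1
      · simp [hy']
      · refine sum_congr rfl fun B hB => ?_
        rw [hy', Function.update_of_ne (by rintro rfl; exact hA hB)]
    have hres : 0 ≤ z u - d u := sub_nonneg.2 (hle u)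
    refine ⟨y', fun B => ?_, fun B hB => ?_, fun v => ?_, fun B hB => ?_⟩
    · rcases eq_or_ne B A with rfl | h
      · simpa [hy'] using hle u
      · simpa [hy', h] using h0 B
    · rw [mem_insert, not_or] at hB
      simpa [hy', hB.1] using hout B hB.2
    · rw [hsum]
      split_ifs with hv
      · linarith [humin v hv]
      · linarith [hle v]
    · rcases mem_insert.1 hB with rfl | hB
      · exact ⟨u, hu, by rw [hsum, if_pos hu]; ring⟩
      · obtain ⟨v, hv, hvs⟩ := hsat B hB
        refine ⟨v, hv, ?_⟩
        rw [hsum]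
        split_ifs with hvA
        -- A vertex of `A` that was already saturated has residual zero, so the increment is zero.
        · have := humin v hvA
          simp only [hd] at *
          linarith
        · rw [zero_add]
          exact hvs

/-! ### Maximal chains, encoded as numberings, through given sets. -/

theorem swap_mem_iff {X : Type*} [DecidableEq X] {x : Finset X} {a b : X} (h : a ∈ x ↔ b ∈ x) (c : X) :
    Equiv.swap a b c ∈ x ↔ c ∈ x := by
  rcases eq_or_ne c a with rfl | hca
  · rw [Equiv.swap_apply_left, h]
  rcases eq_or_ne c b with rfl | hcb
  · rw [Equiv.swap_apply_right, h]
  · rw [Equiv.swap_apply_of_ne_of_ne hca hcb]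

section Prefixes

variable {X : Type*} [Fintype X] [DecidableEq X]

/-- The numberings of which all members of `s` are prefixes. -/
def commonPrefixed (s : Finset (Finset X)) : Finset (Numbering X) :=
  univ.filter fun f => ∀ x ∈ s, f.IsPrefix x

@[simp]
theorem mem_commonPrefixed {s : Finset (Finset X)} {f : Numbering X} :
    f ∈ commonPrefixed s ↔ ∀ x ∈ s, f.IsPrefix x := by
  simp [commonPrefixed]

/-- Adding a new largest set to a collection of prefixes makes the event much rarer. -/
theorem card_commonPrefixed_insert {s : Finset (Finset X)} {y z : Finset X}
    (hs : ∀ u ∈ s, u ⊆ z) (hzy : z ⊆ y) :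
    (commonPrefixed (insert y s)).card * ((y \ z).card * yᶜ.card) ≤ (commonPrefixed s).card := by
  rw [← card_product, ← card_product]
  -- Swapping `a ∈ y \ z` with `b ∉ y` keeps every member of `s` a prefix, as `z` contains neither.
  -- The first `|y|` elements are then `y` with `a` replaced by `b`, which recovers `a`, `b` and
  -- `f`.
  refine card_le_card_of_injOn (fun q => (Equiv.swap q.2.1 q.2.2).trans q.1) ?_ ?_
  · rintro ⟨f, a, b⟩ hq
    simp only [coe_product, Set.mem_prod, mem_coe, mem_commonPrefixed, mem_sdiff,
      mem_compl] at hq ⊢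
    obtain ⟨hf, ⟨-, haz⟩, hby⟩ := hq
    intro u hu c
    rw [Equiv.trans_apply, ← hf u (mem_insert_of_mem hu), swap_mem_iff]
    exact iff_of_false (fun h => haz (hs u hu h)) fun h => hby (hzy (hs u hu h))
  · have key : ∀ (f : Numbering X) (a b : X), f.IsPrefix y → a ∈ y → b ∉ y → ∀ c,
        ((Equiv.swap a b).trans f c < y.card ↔ (c ∈ y ∧ c ≠ a) ∨ c = b) := by
      intro f a b hf ha hb c
      rw [Equiv.trans_apply, ← hf]
      rcases eq_or_ne c a with rfl | hca
      · rw [Equiv.swap_apply_left]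
        exact iff_of_false hb (by rintro (h | rfl); exacts [h.2 rfl, hb ha])
      rcases eq_or_ne c b with rfl | hcb
      · rw [Equiv.swap_apply_right]
        exact iff_of_true ha (Or.inr rfl)
      · rw [Equiv.swap_apply_of_ne_of_ne hca hcb]
        simp [hca, hcb]
    rintro ⟨f, a, b⟩ hq ⟨f', a', b'⟩ hq' heq
    simp only [coe_product, Set.mem_prod, mem_coe, mem_commonPrefixed, mem_sdiff,
      mem_compl] at hq hq' heq
    have k1 := key f a b (hq.1 y (mem_insert_self _ _)) hq.2.1.1 hq.2.2
    have k2 := key f' a' b' (hq'.1 y (mem_insert_self _ _)) hq'.2.1.1 hq'.2.2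
    rw [heq] at k1
    have hk : ∀ c, ((c ∈ y ∧ c ≠ a) ∨ c = b) ↔ ((c ∈ y ∧ c ≠ a') ∨ c = b') :=
      fun c => (k1 c).symm.trans (k2 c)
    have hb : b = b' := by
      rcases (hk b).1 (Or.inr rfl) with h | h
      exacts [absurd h.1 hq.2.2, h]
    have ha : a = a' := by
      by_contra hne
      rcases (hk a).2 (Or.inl ⟨hq.2.1.1, hne⟩) with h | h
      · exact h.2 rfl
      · exact hq.2.2 (h ▸ hq.2.1.1)
    subst ha hb
    have : f = f' := by
      ext c
      have := congrArg (fun e : Numbering X => (e (Equiv.swap a b c) : ℕ)) heq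
      simpa using this
    rw [this]

/-- The number of maximal chains through a chain of sets from the middle layers. -/
theorem card_commonPrefixed_le (k : ℕ) : ∀ s : Finset (Finset X), s.card = k + 1 →
    (∀ u ∈ s, ∀ v ∈ s, u ⊆ v ∨ v ⊆ u) →
    (∀ u ∈ s, Fintype.card X ≤ 3 * u.card ∧ 3 * u.card ≤ 2 * Fintype.card X) →
    ∃ x ∈ s, (commonPrefixed s).card * Fintype.card X ^ k ≤
      6 ^ k * (Numbering.prefixed x).card := by
  induction k with
  | zero =>
    intro s hs _ _
    obtain ⟨x, rfl⟩ := card_eq_one.1 hs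
    refine ⟨x, mem_singleton_self x, ?_⟩
    rw [pow_zero, pow_zero, mul_one, one_mul]
    exact card_le_card fun f hf => by simpa using hf
  | succ k ih =>
    intro s hs hchain hmid
    obtain ⟨y, hy, hymax⟩ := exists_max_image s card (card_pos.1 (by omega))
    have hs' : (s.erase y).card = k + 1 := by rw [card_erase_of_mem hy, hs]; rfl
    obtain ⟨z, hz, hzmax⟩ := exists_max_image (s.erase y) card (card_pos.1 (by omega))
    have hzs := mem_of_mem_erase hz
    have hsub : ∀ u ∈ s, ∀ v ∈ s, u.card ≤ v.card → u ⊆ v := by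
      intro u hu v hv huv
      rcases hchain u hu v hv with h | h
      · exact h
      · exact (eq_of_subset_of_card_le h huv).symm.subset
    have hzy : z ⊆ y := hsub z hzs y hy (hymax z hzs)
    obtain ⟨x, hx, hxc⟩ := ih (s.erase y) hs'
      (fun u hu v hv => hchain u (mem_of_mem_erase hu) v (mem_of_mem_erase hv))
      fun u hu => hmid u (mem_of_mem_erase hu)
    refine ⟨x, mem_of_mem_erase hx, ?_⟩
    have hins := card_commonPrefixed_insert (s := s.erase y) (y := y) (z := z)
      (fun u hu => hsub u (mem_of_mem_erase hu) z hzs (hzmax u hu)) hzy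
    rw [insert_erase hy] at hins
    set P := (commonPrefixed s).card
    set n := Fintype.card X with hn
    -- The two factors are at least 1 and add up to `n - |z| ≥ n / 3`; a product of numbers at least
    -- 1 is at least half their sum.
    have hpair : n ≤ 6 * ((y \ z).card * yᶜ.card) := by
      have h1 : (y \ z).card = y.card - z.card := card_sdiff_of_subset hzy
      have h2 : yᶜ.card = n - y.card := card_compl y
      have h3 : z.card < y.card := card_lt_card
        (hzy.ssubset_of_ne (ne_of_mem_erase hz))
      have h4 := hmid y hy
      have h5 := hmid z hzs
      have hp : 1 ≤ (y \ z).card := by omega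
      have hq : 1 ≤ yᶜ.card := by omega
      have hsum : n ≤ 3 * ((y \ z).card + yᶜ.card) := by omega
      nlinarith
    calc P * n ^ (k + 1) = (P * n) * n ^ k := by ring
      _ ≤ (P * (6 * ((y \ z).card * yᶜ.card))) * n ^ k := by gcongr
      _ = 6 * ((P * ((y \ z).card * yᶜ.card)) * n ^ k) := by ring
      _ ≤ 6 * ((commonPrefixed (s.erase y)).card * n ^ k) := by gcongr
      _ ≤ 6 * (6 ^ k * (Numbering.prefixed x).card) := by gcongr
      _ = _ := by ring

end Prefixes

/-! ### Supersaturation: a spread weight on the bad edges. -/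

section Supersaturation

variable {n m : ℕ}

/-- The set of pairs `(x, c)` with `c ∈ T x`. -/
def Template.pairs (T : Template n m) : Finset (Finset (Fin n) × Fin m) :=
  univ.filter fun v => v.2 ∈ T v.1

@[simp]
theorem Template.mem_pairs {T : Template n m} {v : Finset (Fin n) × Fin m} :
    v ∈ T.pairs ↔ v.2 ∈ T v.1 := by
  simp [Template.pairs]

theorem Template.card_pairs (T : Template n m) : T.pairs.card = T.size := by
  rw [Template.pairs, card_filter, Fintype.sum_prod_type, Template.size]
  exact sum_congr rfl fun x _ => by simp

/-- The colored chains of pairs of `T` that are copies of elements of `𝒢`. -/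
noncomputable def Template.badEdges (𝒢 : Finset (List (Fin m))) (T : Template n m) :
    Finset (Finset (Finset (Fin n) × Fin m)) :=
  open Classical in
  T.pairs.powerset.filter fun A => ∃ g ∈ 𝒢, ∃ x : Fin g.length → Finset (Fin n),
    StrictMono x ∧ A = univ.image fun i => (x i, g.get i)

theorem Template.mem_badEdges {𝒢 : Finset (List (Fin m))} {T : Template n m}
    {A : Finset (Finset (Fin n) × Fin m)} :
    A ∈ T.badEdges 𝒢 ↔ A ⊆ T.pairs ∧ ∃ g ∈ 𝒢, ∃ x : Fin g.length → Finset (Fin n),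
      StrictMono x ∧ A = univ.image fun i => (x i, g.get i) := by
  simp [Template.badEdges]

section BadEdges

variable {𝒢 : Finset (List (Fin m))} {T : Template n m} {A : Finset (Finset (Fin n) × Fin m)}

theorem Template.exists_card_of_mem_badEdges (hA : A ∈ T.badEdges 𝒢) :
    ∃ g ∈ 𝒢, A.card = g.length := by
  obtain ⟨-, g, hg, x, hx, rfl⟩ := Template.mem_badEdges.1 hA
  refine ⟨g, hg, ?_⟩
  rw [card_image_of_injective _ fun i j h => hx.injective (Prod.ext_iff.1 h).1, card_univ,
    Fintype.card_fin]

theorem Template.card_le_of_mem_badEdges (hA : A ∈ T.badEdges 𝒢) :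
    A.card ≤ 𝒢.sup List.length := by
  obtain ⟨g, hg, h⟩ := Template.exists_card_of_mem_badEdges hA
  exact h ▸ le_sup (f := List.length) hg

theorem Template.total_of_mem_badEdges (hA : A ∈ T.badEdges 𝒢) {u v : Finset (Fin n) × Fin m}
    (hu : u ∈ A) (hv : v ∈ A) : u.1 ⊆ v.1 ∨ v.1 ⊆ u.1 := by
  obtain ⟨-, g, hg, x, hx, rfl⟩ := Template.mem_badEdges.1 hA
  obtain ⟨i, -, rfl⟩ := mem_image.1 hu
  obtain ⟨j, -, rfl⟩ := mem_image.1 hv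
  exact (le_total i j).imp (fun h => hx.monotone h) fun h => hx.monotone h

theorem Template.injOn_fst_of_mem_badEdges (hA : A ∈ T.badEdges 𝒢) :
    Set.InjOn Prod.fst (A : Set (Finset (Fin n) × Fin m)) := by
  obtain ⟨-, g, hg, x, hx, rfl⟩ := Template.mem_badEdges.1 hA
  intro u hu v hv h
  obtain ⟨i, -, rfl⟩ := mem_image.1 (mem_coe.1 hu)
  obtain ⟨j, -, rfl⟩ := mem_image.1 (mem_coe.1 hv)
  rw [hx.injective h]

theorem Template.not_subset_of_valid (hA : A ∈ T.badEdges 𝒢) {I : ColoredSubset n m}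
    (hI : I.Valid 𝒢) : ∃ v ∈ A, I v.1 ≠ some v.2 := by
  obtain ⟨-, g, hg, x, hx, rfl⟩ := Template.mem_badEdges.1 hA
  by_contra! h
  exact hI g hg ⟨x, hx, fun i => h _ (mem_image_of_mem _ (mem_univ i))⟩

end BadEdges

/-- The increase of `log (1 + ∑ β)` is at most the sum of the added terms. -/
theorem log_one_add_sum_le {ι : Type*} [DecidableEq ι] {β : ι → ℝ} (hβ : ∀ i, 0 < β i)
    {s t : Finset ι} (hst : s ⊆ t) :
    Real.log (1 + ∑ i ∈ t, β i) ≤ Real.log (1 + ∑ i ∈ s, β i) + ∑ i ∈ t \ s, β i := by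
  have hs : 0 ≤ ∑ i ∈ s, β i := sum_nonneg fun i _ => (hβ i).le
  have hd : 0 ≤ ∑ i ∈ t \ s, β i := sum_nonneg fun i _ => (hβ i).le
  rw [← sum_sdiff hst, ← sub_le_iff_le_add', ← Real.log_div (by positivity) (by positivity)]
  refine (Real.log_le_sub_one_of_pos (by positivity)).trans ?_
  rw [sub_le_iff_le_add, div_le_iff₀ (by positivity)]
  nlinarith

/-- On a maximal chain there is a fractional packing of bad edges that is large if the template has
large weighted weight there. -/
theorem exists_packing_on_chain {𝒢 : Finset (List (Fin m))} (h2 : ∀ g ∈ 𝒢, 2 ≤ g.length)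
    (hsparse : Sparse 𝒢) {β : Fin m → ℝ} (hβ : ∀ i, 0 < β i) {B : ℝ} (hB : ∀ i, β i ≤ B)
    (hB0 : 0 ≤ B) (T : Template n m) (z : Finset (Fin n) → ℝ) (hz0 : ∀ x, 0 ≤ z x)
    (hz1 : ∀ x, z x ≤ 1) (f : Numbering (Fin n)) :
    ∃ y : Finset (Finset (Fin n) × Fin m) → ℝ, (∀ A, 0 ≤ y A) ∧
      (∀ A, (∃ v ∈ A, ¬ f.IsPrefix v.1) → y A = 0) ∧
      (∀ v, ∑ A ∈ T.badEdges 𝒢, (if v ∈ A then y A else 0) ≤ z v.1) ∧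
      ∑ x ∈ univ.filter f.IsPrefix, z x * Real.log (1 + ∑ i ∈ T x, β i) ≤
        omegaCrit 𝒢 β + B * (𝒢.sup List.length) * ∑ A ∈ T.badEdges 𝒢, y A := by
  classical
  set E := (T.badEdges 𝒢).filter fun A => ∀ v ∈ A, f.IsPrefix v.1 with hE
  obtain ⟨y, h0, hout, hle, hsat⟩ := exists_saturating_packing E (fun A hA => by
    obtain ⟨g, hg, h⟩ := Template.exists_card_of_mem_badEdges (mem_filter.1 hA).1
    have := h2 g hg
    exact card_pos.1 (by omega)) (fun v => z v.1) fun v => hz0 v.1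
  have hsum : ∀ q : Finset (Finset (Fin n) × Fin m) → ℝ, (∀ A, y A = 0 → q A = 0) →
      ∑ A ∈ T.badEdges 𝒢, q A = ∑ A ∈ E, q A := fun q hq =>
    (sum_subset (filter_subset _ _) fun A _ hA => hq A (hout A hA)).symm
  have hdeg : ∀ v, ∑ A ∈ T.badEdges 𝒢, (if v ∈ A then y A else 0) =
      ∑ A ∈ E, if v ∈ A then y A else 0 := fun v => hsum _ fun A hA => by simp [hA]
  refine ⟨y, h0, fun A ⟨v, hv, hvf⟩ => hout A fun hA => hvf ((mem_filter.1 hA).2 v hv),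
    fun v => (hdeg v).trans_le (hle v), ?_⟩
  set d : Finset (Fin n) × Fin m → ℝ := fun v => ∑ A ∈ E, if v ∈ A then y A else 0 with hd
  have hd0 : ∀ v, 0 ≤ d v := fun v => sum_nonneg fun A _ => by
    split_ifs
    exacts [h0 A, le_rfl]
  -- Only unsaturated pairs on the chain survive. Every bad edge on the chain has a saturated pair,
  -- so `T'` is valid.
  set T' : Template n m := fun x =>
    if f.IsPrefix x then (T x).filter fun c => d (x, c) ≠ z x else ∅ with hT'
  have hT'f : ∀ x, (T' x).Nonempty → f.IsPrefix x := fun x hx => by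
    by_contra h
    simp [hT', h] at hx
  have hchain : IsChain (· ⊆ ·) (T'.supp : Set (Finset (Fin n))) := by
    intro a ha b hb _
    have ha' := hT'f a (mem_filter.1 (mem_coe.1 ha)).2
    have hb' := hT'f b (mem_filter.1 (mem_coe.1 hb)).2
    exact (le_total a.card b.card).imp (fun h => ha'.subset_of_card_le_card hb' h)
      fun h => hb'.subset_of_card_le_card ha' h
  have hvalid : T'.Valid 𝒢 := by
    rintro S hS g hg ⟨x, hx, hSx⟩
    have hmem : ∀ i, g.get i ∈ T' (x i) := by
      intro i
      by_cases hi : x i ∈ T'.supp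
      · obtain ⟨c, hc, hSc⟩ := hS.1 _ hi
        rw [hSx i, Option.some_inj] at hSc
        exact hSc ▸ hc
      · have := hS.2 _ hi
        rw [hSx i] at this
        simp at this
    have hpre : ∀ i, f.IsPrefix (x i) := fun i => hT'f _ ⟨_, hmem i⟩
    have hmem' : ∀ i, g.get i ∈ T (x i) ∧ d (x i, g.get i) ≠ z (x i) := by
      intro i
      have := hmem i
      simp only [hT', hpre i, if_true] at this
      exact mem_filter.1 this
    have hA : (univ.image fun i => (x i, g.get i)) ∈ E := by
      refine mem_filter.2 ⟨Template.mem_badEdges.2 ⟨?_, g, hg, x, hx, rfl⟩, ?_⟩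
      · intro v hv
        obtain ⟨i, -, rfl⟩ := mem_image.1 hv
        exact Template.mem_pairs.2 (hmem' i).1
      · intro v hv
        obtain ⟨i, -, rfl⟩ := mem_image.1 hv
        exact hpre i
    obtain ⟨v, hv, hvz⟩ := hsat _ hA
    obtain ⟨i, -, rfl⟩ := mem_image.1 hv
    exact (hmem' i).2 hvz
  have hω : T'.weight β ≤ omegaCrit 𝒢 β :=
    (isGreatest_omegaCrit hsparse h2 β).2 ⟨n, T', hvalid, hchain, rfl⟩
  have hlog0 : ∀ s : Finset (Fin m), 0 ≤ Real.log (1 + ∑ i ∈ s, β i) := fun s =>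
    Real.log_nonneg (le_add_of_nonneg_right (sum_nonneg fun i _ => (hβ i).le))
  -- A deleted pair has `d (x, c) = z x`, so its loss `z x * β c` is charged to the packing; `z x ≤
  -- 1` removes the factor from the surviving term.
  have hx : ∀ x ∈ univ.filter f.IsPrefix, z x * Real.log (1 + ∑ i ∈ T x, β i) ≤
      Real.log (1 + ∑ i ∈ T' x, β i) + B * ∑ c, d (x, c) := by
    intro x hx
    have hxf := (mem_filter.1 hx).2
    have hTx : T' x = (T x).filter fun c => d (x, c) ≠ z x := by simp [hT', hxf]
    have h1 := log_one_add_sum_le hβ (s := T' x) (t := T x) (by rw [hTx]; exact filter_subset _ _)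
    have h3 : z x * ∑ c ∈ T x \ T' x, β c ≤ B * ∑ c, d (x, c) := by
      rw [mul_sum, mul_sum]
      calc ∑ c ∈ T x \ T' x, z x * β c ≤ ∑ c ∈ T x \ T' x, B * d (x, c) := by
            refine sum_le_sum fun c hc => ?_
            rw [mem_sdiff, hTx, mem_filter] at hc
            have : d (x, c) = z x := by
              by_contra h
              exact hc.2 ⟨hc.1, h⟩
            rw [this, mul_comm]
            exact mul_le_mul_of_nonneg_right (hB c) (hz0 x)
        _ ≤ _ := sum_le_sum_of_subset_of_nonneg (subset_univ _)
            fun c _ _ => mul_nonneg hB0 (hd0 _)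
    calc z x * Real.log (1 + ∑ i ∈ T x, β i) ≤
          z x * (Real.log (1 + ∑ i ∈ T' x, β i) + ∑ i ∈ T x \ T' x, β i) :=
          mul_le_mul_of_nonneg_left h1 (hz0 x)
      _ = z x * Real.log (1 + ∑ i ∈ T' x, β i) + z x * ∑ c ∈ T x \ T' x, β c := mul_add _ _ _
      _ ≤ _ := add_le_add (mul_le_of_le_one_left (hlog0 _) (hz1 x)) h3
  -- Double counting: an edge has at most `𝒢.sup List.length` vertices.
  have hdtot : ∑ x, ∑ c, d (x, c) ≤ (𝒢.sup List.length : ℕ) * ∑ A ∈ E, y A := by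
    rw [← Fintype.sum_prod_type, hd, sum_comm, mul_sum]
    refine sum_le_sum fun A hA => ?_
    rw [sum_ite_mem, univ_inter, sum_const, nsmul_eq_mul]
    refine mul_le_mul_of_nonneg_right ?_ (h0 A)
    exact_mod_cast Template.card_le_of_mem_badEdges (mem_filter.1 hA).1
  calc _ ≤ ∑ x ∈ univ.filter f.IsPrefix,
        (Real.log (1 + ∑ i ∈ T' x, β i) + B * ∑ c, d (x, c)) := sum_le_sum hx
    _ ≤ ∑ x, (Real.log (1 + ∑ i ∈ T' x, β i) + B * ∑ c, d (x, c)) :=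
        sum_le_sum_of_subset_of_nonneg (subset_univ _) fun x _ _ =>
          add_nonneg (hlog0 _) (mul_nonneg hB0 (sum_nonneg fun c _ => hd0 _))
    _ = T'.weight β + B * ∑ x, ∑ c, d (x, c) := by
        rw [sum_add_distrib, ← mul_sum, Template.weight]
    _ ≤ omegaCrit 𝒢 β + B * ((𝒢.sup List.length : ℕ) * ∑ A ∈ E, y A) :=
        add_le_add hω (mul_le_mul_of_nonneg_left hdtot hB0)
    _ = _ := by rw [hsum y fun A h => h, mul_assoc]

theorem card_prefixed_mul_choose (x : Finset (Fin n)) :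
    (Numbering.prefixed x).card * n.choose x.card = n.factorial := by
  have hx : x.card ≤ n := by simpa using card_le_univ x
  rw [Numbering.card_prefixed, Fintype.card_fin, mul_comm, ← mul_assoc,
    Nat.choose_mul_factorial_mul_factorial hx]

/-- Supersaturation: a template whose weight exceeds the critical one carries a large weight on its
bad edges that is well spread. -/
theorem exists_spread_weight {𝒢 : Finset (List (Fin m))} (h2 : ∀ g ∈ 𝒢, 2 ≤ g.length)
    (hsparse : Sparse 𝒢) {β : Fin m → ℝ} (hβ : ∀ i, 0 < β i) {B : ℝ} (hB : ∀ i, β i ≤ B)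
    (hB0 : 0 ≤ B) (T : Template n m)
    (hT : ∀ x ∈ T.supp, n ≤ 3 * x.card ∧ 3 * x.card ≤ 2 * n) :
    ∃ w : Finset (Finset (Fin n) × Fin m) → ℝ, (∀ A, 0 ≤ w A) ∧
      (T.weight β ≤ omegaCrit 𝒢 β * n.choose (n / 2) +
        B * (𝒢.sup List.length) * ∑ A ∈ T.badEdges 𝒢, w A) ∧
      ∀ X : Finset (Finset (Fin n) × Fin m), X.Nonempty →
        (∑ A ∈ T.badEdges 𝒢, if X ⊆ A then w A else 0) * (n : ℝ) ^ (X.card - 1) ≤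
          6 ^ (X.card - 1) := by
  classical
  have hN : (0 : ℝ) < n.choose (n / 2) := by exact_mod_cast Nat.choose_pos (Nat.div_le_self n 2)
  have hF : (0 : ℝ) < n.factorial := by exact_mod_cast n.factorial_pos
  set N : ℝ := (n.choose (n / 2) : ℝ) with hNdef
  -- A random maximal chain meets `x` with probability `1 / n.choose x.card`, so this capacity gives
  -- every `x` the same expected contribution `1 / N`.
  set z : Finset (Fin n) → ℝ := fun x => n.choose x.card / N with hz
  have hz0 : ∀ x, 0 ≤ z x := fun x => by positivity
  have hz1 : ∀ x, z x ≤ 1 := fun x => by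
    rw [hz, div_le_one hN, hNdef]
    exact_mod_cast Nat.choose_le_middle _ _
  have hpz : ∀ x, ((Numbering.prefixed x).card : ℝ) * z x = n.factorial / N := fun x => by
    rw [hz, ← mul_div_assoc]
    congr 1
    exact_mod_cast card_prefixed_mul_choose x
  choose y hy0 hyout hyz hyw using
    exists_packing_on_chain h2 hsparse hβ hB hB0 T z hz0 hz1
  have hcardN : (univ : Finset (Numbering (Fin n))).card = n.factorial := by
    rw [card_univ, Fintype.card_numbering, Fintype.card_fin]
  refine ⟨fun A => N / n.factorial * ∑ f, y f A,
    fun A => mul_nonneg (by positivity) (sum_nonneg fun f _ => hy0 f A), ?_, ?_⟩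
  · have h1 := sum_le_sum fun f (_ : f ∈ univ) => hyw f
    simp only [sum_filter] at h1
    rw [sum_comm] at h1
    have h3 : ∀ x, (∑ f : Numbering (Fin n), if f.IsPrefix x then
        z x * Real.log (1 + ∑ i ∈ T x, β i) else 0) =
        n.factorial / N * Real.log (1 + ∑ i ∈ T x, β i) := by
      intro x
      rw [← sum_filter, sum_const, nsmul_eq_mul, ← mul_assoc]
      congr 1
      exact hpz x
    rw [sum_congr rfl fun x _ => h3 x, ← mul_sum, sum_add_distrib, sum_const, hcardN, ← mul_sum,
      nsmul_eq_mul, sum_comm] at h1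
    rw [← mul_sum]
    have h4 : T.weight β = N / n.factorial * (n.factorial / N * T.weight β) := by
      field_simp
    rw [h4]
    refine (mul_le_mul_of_nonneg_left h1 (by positivity)).trans_eq ?_
    field_simp
  · intro X hX
    by_cases hXE : ∃ A ∈ T.badEdges 𝒢, X ⊆ A
    swap
    · rw [sum_eq_zero fun A hA => if_neg fun h => hXE ⟨A, hA, h⟩, zero_mul]
      positivity
    obtain ⟨A, hA, hXA⟩ := hXE
    have hcard : (X.image Prod.fst).card = X.card :=
      card_image_of_injOn ((Template.injOn_fst_of_mem_badEdges hA).mono (by simpa using hXA))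
    have hXpos := hX.card_pos
    obtain ⟨x, hx, hxc⟩ := card_commonPrefixed_le (X.card - 1) (X.image Prod.fst)
      (by omega)
      (by
        intro u hu v hv
        obtain ⟨u', hu', rfl⟩ := mem_image.1 hu
        obtain ⟨v', hv', rfl⟩ := mem_image.1 hv
        exact Template.total_of_mem_badEdges hA (hXA hu') (hXA hv'))
      (by
        intro u hu
        obtain ⟨u', hu', rfl⟩ := mem_image.1 hu
        rw [Fintype.card_fin]
        have := (Template.mem_badEdges.1 hA).1 (hXA hu')
        exact hT _ (mem_filter.2 ⟨mem_univ _, _, Template.mem_pairs.1 this⟩))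
    rw [Fintype.card_fin] at hxc
    obtain ⟨v, hv, rfl⟩ := mem_image.1 hx
    -- Only chains through all sets of `X` contribute, each at most the capacity of the single
    -- vertex `v ∈ X`.
    have hf : ∀ f : Numbering (Fin n), ∑ A ∈ T.badEdges 𝒢, (if X ⊆ A then y f A else 0) ≤
        if f ∈ commonPrefixed (X.image Prod.fst) then z v.1 else 0 := by
      intro f
      split_ifs with hfX
      · refine le_trans (sum_le_sum fun A _ => ?_) (hyz f v)
        by_cases hXA : X ⊆ A
        · rw [if_pos hXA, if_pos (hXA hv)]
        · rw [if_neg hXA]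
          split_ifs
          exacts [hy0 f A, le_rfl]
      · refine (sum_eq_zero fun A _ => ?_).le
        split_ifs with hXA
        · simp only [mem_commonPrefixed, mem_image, not_forall] at hfX
          obtain ⟨_, ⟨u, hu, rfl⟩, huf⟩ := hfX
          exact hyout f A ⟨u, hXA hu, huf⟩
        · rfl
    have htot : ∑ A ∈ T.badEdges 𝒢, (if X ⊆ A then N / n.factorial * ∑ f, y f A else 0) ≤
        N / n.factorial * ((commonPrefixed (X.image Prod.fst)).card * z v.1) := by
      have h1 := sum_le_sum fun f (_ : f ∈ univ) => hf f
      rw [sum_ite_mem, univ_inter, sum_const, nsmul_eq_mul, sum_comm] at h1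
      refine le_trans (le_of_eq ?_) (mul_le_mul_of_nonneg_left h1 (by positivity))
      rw [mul_sum]
      refine sum_congr rfl fun A _ => ?_
      split_ifs <;> simp
    have hxc' : ((commonPrefixed (X.image Prod.fst)).card : ℝ) * (n : ℝ) ^ (X.card - 1) ≤
        6 ^ (X.card - 1) * (Numbering.prefixed v.1).card := by exact_mod_cast hxc
    calc _ ≤ N / n.factorial * ((commonPrefixed (X.image Prod.fst)).card * z v.1) *
          (n : ℝ) ^ (X.card - 1) := mul_le_mul_of_nonneg_right htot (by positivity)
      _ = N / n.factorial * z v.1 *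
          ((commonPrefixed (X.image Prod.fst)).card * (n : ℝ) ^ (X.card - 1)) := by ring
      _ ≤ N / n.factorial * z v.1 * (6 ^ (X.card - 1) * (Numbering.prefixed v.1).card) :=
          mul_le_mul_of_nonneg_left hxc' (mul_nonneg (by positivity) (hz0 _))
      _ = N / n.factorial * 6 ^ (X.card - 1) * ((Numbering.prefixed v.1).card * z v.1) := by ring
      _ = 6 ^ (X.card - 1) := by
          rw [hpz]
          field_simp

end Supersaturation

/-! ### Counting fingerprints and choosing a uniformity. -/

theorem exists_pos_forall_le {ι : Type*} (s : Finset ι) (f : ι → ℝ) (hf : ∀ i ∈ s, 0 < f i) :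
    ∃ δ : ℝ, 0 < δ ∧ ∀ i ∈ s, δ ≤ f i := by
  rcases s.eq_empty_or_nonempty with rfl | hs
  · exact ⟨1, one_pos, by simp⟩
  · obtain ⟨i, hi, hmin⟩ := exists_min_image s f hs
    exact ⟨f i, hf i hi, hmin⟩

/-- Exponential weighting: give `S` the weight `n ^ (-|S|)`. The total is `(1 + 1 / n) ^ |V| ≤ exp
(|V| / n)`, while each counted set has weight at least `n ^ (-6 |V| / n)`. The remaining `|V| / n`
is absorbed through `log n ≥ 1`, turning 6 into 7. -/
theorem card_filter_card_le {α : Type*} [DecidableEq α] (V : Finset α) {n : ℕ} (hn : 3 ≤ n) :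
    ((V.powerset.filter fun S => (S.card : ℝ) ≤ 6 / n * V.card).card : ℝ) ≤
      Real.exp (7 * (Real.log n / n) * V.card) := by
  set N : ℝ := (V.card : ℝ) with hN
  have hn0 : (0 : ℝ) < n := by exact_mod_cast (by omega : 0 < n)
  have hlog : 1 ≤ Real.log n := by
    rw [Real.le_log_iff_exp_le hn0]
    have : (3 : ℝ) ≤ n := by exact_mod_cast hn
    linarith [Real.exp_one_lt_d9]
  set r : ℝ := 6 / n * N with hr
  have h1 : ((V.powerset.filter fun S => (S.card : ℝ) ≤ r).card : ℝ) *
      Real.exp (-(r * Real.log n)) ≤ Real.exp (N / n) := by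
    calc _ = ∑ S ∈ V.powerset.filter fun S => (S.card : ℝ) ≤ r,
          Real.exp (-(r * Real.log n)) := by rw [sum_const, nsmul_eq_mul]
      _ ≤ ∑ S ∈ V.powerset.filter fun S => (S.card : ℝ) ≤ r, (1 / n : ℝ) ^ S.card := by
          refine sum_le_sum fun S hS => ?_
          have hle := (mem_filter.1 hS).2
          have : (1 / n : ℝ) = Real.exp (-Real.log n) := by
            rw [Real.exp_neg, Real.exp_log hn0, one_div]
          rw [this, ← Real.exp_nat_mul, Real.exp_le_exp]
          nlinarith
      _ ≤ ∑ S ∈ V.powerset, (1 / n : ℝ) ^ S.card :=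
          sum_le_sum_of_subset_of_nonneg (filter_subset _ _) fun _ _ _ => by positivity
      _ = (1 / n + 1 : ℝ) ^ V.card := by
          rw [← sum_pow_mul_eq_add_pow]
          simp
      _ ≤ Real.exp (1 / n) ^ V.card := by
          gcongr
          exact Real.add_one_le_exp _
      _ = Real.exp (N / n) := by
          rw [← Real.exp_nat_mul]
          congr 1
          rw [hN]
          ring
  rw [Real.exp_neg, ← div_eq_mul_inv, div_le_iff₀ (Real.exp_pos _), ← Real.exp_add] at h1
  refine h1.trans (Real.exp_le_exp.2 ?_)
  have h2 : 7 * (Real.log n / n) * N = N / n * Real.log n + r * Real.log n := by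
    rw [hr]
    ring
  rw [h2]
  have h3 : 0 ≤ N / n := by positivity
  nlinarith

theorem card_filter_card_le_pow {α : Type*} [DecidableEq α] (V : Finset α) {n : ℕ} (hn : 3 ≤ n)
    {k L : ℕ} (hk : k ≤ L) :
    (((V.powerset.filter fun S => (S.card : ℝ) ≤ 6 / n * V.card).card ^ k : ℕ) : ℝ) ≤
      Real.exp (7 * L * (Real.log n / n) * V.card) := by
  have hlog : 0 ≤ Real.log n / n := div_nonneg (Real.log_natCast_nonneg n) (Nat.cast_nonneg n)
  rw [Nat.cast_pow]
  refine (pow_le_pow_left₀ (Nat.cast_nonneg _) (card_filter_card_le V hn) k).trans ?_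
  rw [← Real.exp_nat_mul, Real.exp_le_exp]
  have hk' : (k : ℝ) ≤ L := by exact_mod_cast hk
  calc (k : ℝ) * (7 * (Real.log n / n) * V.card) ≤ L * (7 * (Real.log n / n) * V.card) :=
        mul_le_mul_of_nonneg_right hk' (by positivity)
    _ = _ := by ring

/-- Some uniformity class carries a positive proportion of the weight of a hypergraph. -/
theorem exists_le_wdeg {α : Type*} [DecidableEq α] {V : Finset α} {E : Finset (Finset α)}
    {w w' : Finset α → ℝ} {L : ℕ} (hw : ∀ A, 0 ≤ w' A) (hE : ∀ A ∈ E, A ⊆ V)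
    (hww : ∀ A ∈ E, w' A = w A) (hL : ∀ A ∈ E, A.card ≤ L) :
    ∃ j ∈ range (L + 1), (∑ A ∈ E, w A) / (L + 1) ≤ wdeg V j w' ∅ := by
  refine exists_le_of_sum_le ⟨0, by simp⟩ ?_
  have hmaps : ∀ A ∈ E, A.card ∈ range (L + 1) := fun A hA =>
    mem_range.2 (Nat.lt_succ_of_le (hL A hA))
  rw [sum_const, card_range, nsmul_eq_mul, Nat.cast_add, Nat.cast_one,
    mul_div_cancel₀ _ (by positivity), ← sum_congr rfl hww, ← sum_fiberwise_of_maps_to hmaps]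
  refine sum_le_sum fun j _ => ?_
  rw [wdeg_empty]
  refine sum_le_sum_of_subset_of_nonneg (fun A hA => ?_) fun A _ _ => hw A
  rw [mem_filter] at hA
  exact mem_powersetCard.2 ⟨hE A hA.1, hA.2⟩

/-! ### Templates as sets of pairs; weight against size. -/

section Conversion

variable {n m : ℕ}

/-- The template with a given set of pairs. -/
def Template.ofPairs (C : Finset (Finset (Fin n) × Fin m)) : Template n m :=
  fun x => univ.filter fun c => (x, c) ∈ C

theorem Template.pairs_ofPairs (C : Finset (Finset (Fin n) × Fin m)) :
    (Template.ofPairs C).pairs = C := by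
  ext v
  simp [Template.ofPairs]

/-- Containers for sets of pairs without bad edges give containers for colored subsets. -/
theorem exists_templates_of_containers {𝒢 : Finset (List (Fin m))} {T : Template n m}
    (𝒟 : Finset (Finset (Finset (Fin n) × Fin m))) {e s : ℝ} (hcard : (𝒟.card : ℝ) ≤ e)
    (hsub : ∀ D ∈ 𝒟, D ⊆ T.pairs ∧ (D.card : ℝ) ≤ s)
    (hcover : ∀ I ⊆ T.pairs, (∀ A ∈ T.badEdges 𝒢, ¬ A ⊆ I) → ∃ D ∈ 𝒟, I ⊆ D) :
    ∃ 𝒞 : Finset (Template n m), (∀ T' ∈ 𝒞, T' ≤ T) ∧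
      (∀ I : ColoredSubset n m, I.Valid 𝒢 → I.ContainedIn T → ∃ T' ∈ 𝒞, I.ContainedIn T') ∧
      (𝒞.card : ℝ) ≤ e ∧ ∀ T' ∈ 𝒞, (T'.size : ℝ) ≤ s := by
  classical
  refine ⟨𝒟.image Template.ofPairs, ?_, ?_, ?_, ?_⟩
  · intro T' hT' x c hc
    obtain ⟨D, hD, rfl⟩ := mem_image.1 hT'
    exact Template.mem_pairs.1 ((hsub D hD).1 (mem_filter.1 hc).2)
  · intro I hI hIT
    obtain ⟨D, hD, hID⟩ := hcover (T.pairs.filter fun v => I v.1 = some v.2) (filter_subset _ _)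
      fun A hA hAI => by
        obtain ⟨v, hv, hne⟩ := Template.not_subset_of_valid hA hI
        exact hne (mem_filter.1 (hAI hv)).2
    refine ⟨_, mem_image_of_mem _ hD, fun x c hc => mem_filter.2 ⟨mem_univ _, hID ?_⟩⟩
    exact mem_filter.2 ⟨Template.mem_pairs.2 (hIT x c hc), hc⟩
  · exact le_trans (by exact_mod_cast card_image_le) hcard
  · intro T' hT'
    obtain ⟨D, hD, rfl⟩ := mem_image.1 hT'
    rw [← Template.card_pairs, Template.pairs_ofPairs]
    exact (hsub D hD).2

theorem Template.size_le (T : Template n m) : T.size ≤ m * 2 ^ n := by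
  rw [← Template.card_pairs]
  refine (card_le_univ _).trans_eq ?_
  simp [mul_comm]

theorem Template.weight_le {β : Fin m → ℝ} (hβ : ∀ i, 0 < β i) {B : ℝ} (hB : ∀ i, β i ≤ B)
    (T : Template n m) : T.weight β ≤ B * T.size := by
  rw [Template.weight, Template.size, Nat.cast_sum, mul_sum]
  refine sum_le_sum fun x _ => ?_
  have h0 : 0 ≤ ∑ i ∈ T x, β i := sum_nonneg fun i _ => (hβ i).le
  have h1 := Real.log_le_sub_one_of_pos (by positivity : 0 < 1 + ∑ i ∈ T x, β i)
  have h2 := sum_le_card_nsmul (T x) β B fun i _ => hB i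
  rw [nsmul_eq_mul] at h2
  linarith

/-- There are finitely many nonempty color sets, so the weight per color has a positive minimum,
independent of `n`. -/
theorem exists_mul_size_le_weight {β : Fin m → ℝ} (hβ : ∀ i, 0 < β i) :
    ∃ b : ℝ, 0 < b ∧ ∀ (n : ℕ) (T : Template n m), b * T.size ≤ T.weight β := by
  have hpos : ∀ s : Finset (Fin m), s.Nonempty → 0 < Real.log (1 + ∑ i ∈ s, β i) := fun s hs =>
    Real.log_pos (lt_add_of_pos_right _ (sum_pos (fun i _ => hβ i) hs))
  obtain ⟨b, hb, hle⟩ := exists_pos_forall_le (univ.filter fun s : Finset (Fin m) => s.Nonempty)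
    (fun s => Real.log (1 + ∑ i ∈ s, β i) / s.card) fun s hs => by
      have hs' := (mem_filter.1 hs).2
      exact div_pos (hpos s hs') (by exact_mod_cast hs'.card_pos)
  refine ⟨b, hb, fun n T => ?_⟩
  rw [Template.weight, Template.size, Nat.cast_sum, mul_sum]
  refine sum_le_sum fun x _ => ?_
  rcases (T x).eq_empty_or_nonempty with h | h
  · simp [h]
  · have := hle (T x) (mem_filter.2 ⟨mem_univ _, h⟩)
    rwa [le_div_iff₀ (by exact_mod_cast h.card_pos)] at this

/-- On `𝒫([0])` there is only one set, so a single color there contains no forbidden chain. -/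
theorem omegaCrit_pos {𝒢 : Finset (List (Fin m))} (h2 : ∀ g ∈ 𝒢, 2 ≤ g.length)
    (hsparse : Sparse 𝒢) {β : Fin m → ℝ} (hβ : ∀ i, 0 < β i) (c : Fin m) :
    0 < omegaCrit 𝒢 β := by
  have hmem : Real.log (1 + β c) ∈ chainWeights 𝒢 β := by
    refine ⟨0, fun _ => {c}, ?_, ?_, by simp [Template.weight]⟩
    · rintro S - g hg ⟨x, hx, -⟩
      have := h2 g hg
      have hlt : (⟨0, by omega⟩ : Fin g.length) < ⟨1, by omega⟩ := by simp
      exact (hx hlt).ne (Subsingleton.elim _ _)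
    · exact fun a _ b _ h => absurd (Subsingleton.elim a b) h
  exact lt_of_lt_of_le (Real.log_pos (lt_add_of_pos_right _ (hβ c)))
    ((isGreatest_omegaCrit hsparse h2 β).2 hmem)

theorem three_le_of_mem_badEdges {𝒢 : Finset (List (Fin m))} (h2 : ∀ g ∈ 𝒢, 2 ≤ g.length)
    {T : Template n m} (hT : ∀ x ∈ T.supp, n ≤ 3 * x.card ∧ 3 * x.card ≤ 2 * n)
    {A : Finset (Finset (Fin n) × Fin m)} (hA : A ∈ T.badEdges 𝒢) : 3 ≤ n := by
  obtain ⟨hAT, g, hg, x, hx, rfl⟩ := Template.mem_badEdges.1 hA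
  have := h2 g hg
  have hlt : (⟨0, by omega⟩ : Fin g.length) < ⟨1, by omega⟩ := by simp
  have hc := card_lt_card (hx hlt)
  have hmid := fun i => hT (x i) (mem_filter.2 ⟨mem_univ _, _, Template.mem_pairs.1
    (hAT (mem_image_of_mem _ (mem_univ i)))⟩)
  have h3 := hmid ⟨0, by omega⟩
  have h4 := hmid ⟨1, by omega⟩
  omega

end Conversion

/-! ### Assembly of the container family. -/

/-- Passing to one uniformity class of a spread weight on the bad edges. -/
theorem exists_uniform_spread_weight {n m : ℕ} {𝒢 : Finset (List (Fin m))}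
    (h2 : ∀ g ∈ 𝒢, 2 ≤ g.length) {T : Template n m}
    {w : Finset (Finset (Fin n) × Fin m) → ℝ} (hw0 : ∀ A, 0 ≤ w A)
    (hspread : ∀ X : Finset (Finset (Fin n) × Fin m), X.Nonempty →
      (∑ A ∈ T.badEdges 𝒢, if X ⊆ A then w A else 0) * (n : ℝ) ^ (X.card - 1) ≤
        6 ^ (X.card - 1))
    {κ : ℝ} (hκ : 0 < κ) (hsize : (0 : ℝ) < T.size)
    (hW : κ * T.size ≤ ∑ A ∈ T.badEdges 𝒢, w A) :
    ∃ k < 𝒢.sup List.length, ∃ w' : Finset (Finset (Fin n) × Fin m) → ℝ, (∀ A, 0 ≤ w' A) ∧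
      (∀ A ∉ T.badEdges 𝒢, w' A = 0) ∧ 0 < wdeg T.pairs (k + 1) w' ∅ ∧
      ∀ X : Finset (Finset (Fin n) × Fin m), X.Nonempty →
        wdeg T.pairs (k + 1) w' X * T.pairs.card ≤
          max 1 (((𝒢.sup List.length : ℕ) + 1) / κ) * (6 / n : ℝ) ^ (X.card - 1) *
            wdeg T.pairs (k + 1) w' ∅ := by
  classical
  have hn0 : (0 : ℝ) < n := by
    have hE : (T.badEdges 𝒢).Nonempty := by
      by_contra h
      rw [not_nonempty_iff_eq_empty.1 h, sum_empty] at hW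
      exact absurd hW (not_le.2 (mul_pos hκ hsize))
    obtain ⟨A, hA⟩ := hE
    obtain ⟨-, g, hg, x, hx, rfl⟩ := Template.mem_badEdges.1 hA
    have := h2 g hg
    have hlt : (⟨0, by omega⟩ : Fin g.length) < ⟨1, by omega⟩ := by simp
    have h3 := card_lt_card (hx hlt)
    have h4 := card_le_univ (x ⟨1, by omega⟩)
    rw [Fintype.card_fin] at h4
    exact_mod_cast (by omega : 0 < n)
  set w' : Finset (Finset (Fin n) × Fin m) → ℝ := fun A => if A ∈ T.badEdges 𝒢 then w A else 0
    with hw'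
  have hw'0 : ∀ A, 0 ≤ w' A := fun A => by
    simp only [hw']
    split_ifs
    exacts [hw0 A, le_rfl]
  obtain ⟨j, hj, hjW⟩ := exists_le_wdeg (V := T.pairs) (w := w) hw'0
    (fun A hA => (Template.mem_badEdges.1 hA).1) (fun A hA => if_pos hA)
    fun A hA => Template.card_le_of_mem_badEdges hA
  have hL : (0 : ℝ) < (𝒢.sup List.length : ℕ) + 1 := Nat.cast_add_one_pos _
  rw [div_le_iff₀ hL] at hjW
  have hjpos : 0 < wdeg T.pairs j w' ∅ :=
    pos_of_mul_pos_left (lt_of_lt_of_le (mul_pos hκ hsize) (hW.trans hjW)) hL.le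
  obtain ⟨k, rfl⟩ : ∃ k, j = k + 1 := by
    refine Nat.exists_eq_succ_of_ne_zero ?_
    rintro rfl
    rw [wdeg_empty, powersetCard_zero, sum_singleton] at hjpos
    have hne : ∅ ∉ T.badEdges 𝒢 := fun h => by
      obtain ⟨g, hg, hc⟩ := Template.exists_card_of_mem_badEdges h
      have := h2 g hg
      rw [card_empty] at hc
      omega
    simp [hw', hne] at hjpos
  refine ⟨k, by simpa using hj, w', hw'0, fun A hA => if_neg hA, hjpos, fun X hX => ?_⟩
  have h1 : wdeg T.pairs (k + 1) w' X ≤ (6 / n : ℝ) ^ (X.card - 1) := by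
    rw [div_pow, le_div_iff₀ (pow_pos hn0 _)]
    refine le_trans (mul_le_mul_of_nonneg_right ?_ (pow_pos hn0 _).le) (hspread X hX)
    rw [wdeg, ← sum_filter, ← sum_filter]
    refine sum_le_sum_of_subset_of_nonneg (fun A hA => ?_) fun A _ _ => hw0 A
    simp only [mem_filter] at hA ⊢
    exact ⟨hA.2, hA.1.2⟩
  have h4 : (T.size : ℝ) ≤ ((𝒢.sup List.length : ℕ) + 1) / κ * wdeg T.pairs (k + 1) w' ∅ := by
    rw [div_mul_eq_mul_div, le_div_iff₀ hκ]
    linarith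
  rw [Template.card_pairs]
  have hp : 0 ≤ (6 / n : ℝ) ^ (X.card - 1) := by positivity
  refine (mul_le_mul h1 h4 hsize.le hp).trans ?_
  rw [mul_left_comm, ← mul_assoc]
  exact mul_le_mul_of_nonneg_right (mul_le_mul_of_nonneg_right (le_max_right _ _) hp) hjpos.le

/-- The container family for large ground sets. -/
theorem exists_containers_of_large {m : ℕ} {𝒢 : Finset (List (Fin m))}
    (h2 : ∀ g ∈ 𝒢, 2 ≤ g.length) (hsparse : Sparse 𝒢) {β : Fin m → ℝ} (hβ : ∀ i, 0 < β i)
    (hω : 0 < omegaCrit 𝒢 β) {α : ℝ} (hα : 0 < α) :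
    ∃ (ε : ℝ) (n₀ : ℕ), 0 < ε ∧ ∀ (n : ℕ) (T : Template n m), n₀ ≤ n →
      (∀ x ∈ T.supp, n ≤ 3 * x.card ∧ 3 * x.card ≤ 2 * n) →
      (omegaCrit 𝒢 β + α) * n.choose (n / 2) ≤ T.weight β →
      ∃ 𝒟 : Finset (Finset (Finset (Fin n) × Fin m)),
        (𝒟.card : ℝ) ≤ Real.exp (7 * 𝒢.sup List.length * (Real.log n / n) * T.size) ∧
        (∀ D ∈ 𝒟, D ⊆ T.pairs ∧ (D.card : ℝ) ≤ (1 - ε) * T.size) ∧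
        ∀ I ⊆ T.pairs, (∀ A ∈ T.badEdges 𝒢, ¬ A ⊆ I) → ∃ D ∈ 𝒟, I ⊆ D := by
  classical
  set ω := omegaCrit 𝒢 β with hωdef
  set L := 𝒢.sup List.length with hL
  obtain ⟨b, hb, hbT⟩ := exists_mul_size_le_weight hβ
  set B : ℝ := 1 + ∑ i, β i with hBdef
  have hsum0 : 0 ≤ ∑ i, β i := sum_nonneg fun i _ => (hβ i).le
  have hB0 : 0 < B := by positivity
  have hB : ∀ i, β i ≤ B := fun i => by
    have := single_le_sum (fun i _ => (hβ i).le) (mem_univ i) (f := β)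
    linarith
  set κ : ℝ := b * α / ((ω + α) * (B * (L + 1))) with hκ
  have hκ0 : 0 < κ := by positivity
  choose δ hδ M hM using fun k => exists_containers k (max 1 ((L + 1) / κ)) (le_max_left _ _)
  obtain ⟨ε, hε, hεδ⟩ := exists_pos_forall_le (range L) δ fun k _ => hδ k
  set M₀ : ℝ := ∑ k ∈ range L, |M k| with hM₀
  obtain ⟨n₁, hn₁⟩ := exists_nat_ge (M₀ * B / (3 * ω) + 1)
  refine ⟨ε, max 6 n₁, hε, fun n T hn hT hw => ?_⟩
  have hn6 : 6 ≤ n := (le_max_left _ _).trans hn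
  have hn6' : (6 : ℝ) ≤ n := by exact_mod_cast hn6
  have hn0 : (0 : ℝ) < n := by linarith
  have hnM : M₀ * B / (3 * ω) + 1 ≤ n :=
    hn₁.trans (by exact_mod_cast (le_max_right _ _).trans hn)
  have hN0 : (0 : ℝ) < n.choose (n / 2) := by exact_mod_cast Nat.choose_pos (Nat.div_le_self n 2)
  obtain ⟨w, hw0, hwT, hspread⟩ := exists_spread_weight h2 hsparse hβ hB hB0.le T hT
  set N : ℝ := (n.choose (n / 2) : ℝ) with hNdef
  clear_value N
  set Wt := ∑ A ∈ T.badEdges 𝒢, w A with hWt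
  have hWt0 : 0 ≤ Wt := sum_nonneg fun A _ => hw0 A
  have hsize : ω * N ≤ B * T.size := by
    have := T.weight_le hβ hB
    nlinarith
  have hsize0 : (0 : ℝ) < T.size := by
    have : 0 < B * (T.size : ℝ) := lt_of_lt_of_le (by positivity) hsize
    exact pos_of_mul_pos_right this hB0.le
  have hWκ : κ * T.size ≤ Wt := by
    rw [hκ, div_mul_eq_mul_div, div_le_iff₀ (by positivity)]
    have h1 := hbT n T
    -- Eliminate `N` between `(ω + α) N ≤ weight` and `weight ≤ ω N + B L Wt`.
    have h3 : α * T.weight β ≤ (ω + α) * (B * L * Wt) := by nlinarith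
    have h4 : B * L * Wt ≤ B * (L + 1) * Wt := by nlinarith
    calc b * α * T.size = α * (b * T.size) := by ring
      _ ≤ α * T.weight β := mul_le_mul_of_nonneg_left h1 hα.le
      _ ≤ (ω + α) * (B * (L + 1) * Wt) :=
          h3.trans (mul_le_mul_of_nonneg_left h4 (by positivity))
      _ = _ := by ring
  clear_value Wt
  obtain ⟨k, hkL, w', hw'0, hw'out, hpos, hdeg⟩ :=
    exists_uniform_spread_weight h2 hw0 hspread hκ0 hsize0 (hWt ▸ hWκ)
  have hMk : M k ≤ 6 / n * T.size := by
    have h1 : M k ≤ M₀ := (le_abs_self _).trans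
      (single_le_sum (f := fun k => |M k|) (fun k _ => abs_nonneg _) (mem_range.2 hkL))
    -- The middle binomial coefficient is at least quadratic in `n`, so `(6 / n) |T|` grows with `n`
    -- and eventually passes the threshold `M k`.
    have h3 : (n : ℝ) * (n - 1) / 2 ≤ N := by
      rw [← Nat.cast_choose_two, hNdef]
      exact_mod_cast Nat.choose_le_middle 2 n
    have h4 : M₀ * B ≤ 3 * ω * (n - 1) := by
      have : M₀ * B / (3 * ω) ≤ n - 1 := by linarith
      rwa [div_le_iff₀ (by positivity), mul_comm (_ - 1)] at this
    refine h1.trans ?_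
    rw [div_mul_eq_mul_div, le_div_iff₀ hn0]
    refine le_of_mul_le_mul_right ?_ hB0
    calc M₀ * n * B = (M₀ * B) * n := by ring
      _ ≤ 3 * ω * (n - 1) * n := mul_le_mul_of_nonneg_right h4 hn0.le
      _ = 6 * (ω * (n * (n - 1) / 2)) := by ring
      _ ≤ 6 * (ω * N) := by gcongr
      _ ≤ 6 * (B * T.size) := by gcongr
      _ = _ := by ring
  obtain ⟨𝒟, hcard, hsub, hcover⟩ := hM k _ T.pairs (6 / n) w' (div_pos (by norm_num) hn0)
    (by rwa [div_le_one hn0]) (by rwa [Template.card_pairs]) (fun A _ => hw'0 A) hpos hdeg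
  refine ⟨𝒟, ?_, fun D hD => ⟨(hsub D hD).1, (hsub D hD).2.trans ?_⟩, fun I hI hind => ?_⟩
  · have h1 := card_filter_card_le_pow T.pairs (n := n) (by omega) hkL.le
    rw [Template.card_pairs] at h1 hcard
    exact (Nat.cast_le.2 hcard).trans h1
  · rw [Template.card_pairs]
    have := hεδ k (mem_range.2 hkL)
    gcongr
  · exact hcover I hI fun A hA => hw'out A fun h => hind A h hA

end ColoredChains

theorem mainTheorem5 (m : ℕ) (𝒢 : Finset (List (Fin m)))
    (h2 : ∀ g ∈ 𝒢, 2 ≤ g.length) (hsparse : ColoredChains.Sparse 𝒢)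
    (β : Fin m → ℝ) (hβ : ∀ i, 0 < β i) :
    ∃ K : ℝ, 0 < K ∧ ∀ α : ℝ, 0 < α → α < 1 → ∃ ε : ℝ, 0 < ε ∧
      ∀ (n : ℕ) (T : ColoredChains.Template n m),
        (∀ x ∈ T.supp, (n : ℝ) / 3 ≤ (x.card : ℝ) ∧ (x.card : ℝ) ≤ 2 * (n : ℝ) / 3) →
        (ColoredChains.omegaCrit 𝒢 β + α) * (n.choose (n / 2) : ℝ) ≤ T.weight β →
        ∃ 𝒞 : Finset (ColoredChains.Template n m),
          (∀ T' ∈ 𝒞, T' ≤ T) ∧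
          (∀ I : ColoredChains.ColoredSubset n m, I.Valid 𝒢 → I.ContainedIn T →
            ∃ T' ∈ 𝒞, I.ContainedIn T') ∧
          (𝒞.card : ℝ) ≤ Real.exp (K * (Real.log (n : ℝ) / (n : ℝ)) * (T.size : ℝ)) ∧
          ∀ T' ∈ 𝒞, (T'.size : ℝ) ≤ (1 - ε) * (T.size : ℝ) := by
  classical
  rcases isEmpty_or_nonempty (Fin m) with hm | ⟨⟨c⟩⟩
  -- Without colors all weights vanish, which contradicts the weight hypothesis.
  · have hzero : ∀ (n : ℕ) (T : ColoredChains.Template n m), T.weight β = 0 := fun n T => by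
      simp [ColoredChains.Template.weight, Finset.eq_empty_of_isEmpty]
    refine ⟨1, one_pos, fun α hα _ => ⟨1, one_pos, fun n T _ hw => ?_⟩⟩
    obtain ⟨n', T', -, -, hω⟩ := (ColoredChains.isGreatest_omegaCrit hsparse h2 β).1
    have hN : (0 : ℝ) < n.choose (n / 2) := by
      exact_mod_cast Nat.choose_pos (Nat.div_le_self n 2)
    rw [hω, hzero, hzero, zero_add] at hw
    exact absurd hw (not_le.2 (by positivity))
  have hω := ColoredChains.omegaCrit_pos h2 hsparse hβ c
  set ω := ColoredChains.omegaCrit 𝒢 β with hωdef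
  set L := 𝒢.sup List.length with hL
  have hL1 : 1 ≤ L := by
    obtain ⟨ℓ, hℓ⟩ := hsparse c
    have h1 := h2 _ hℓ
    have h3 : (List.replicate ℓ c).length ≤ L := Finset.le_sup (f := List.length) hℓ
    omega
  have hL1' : (1 : ℝ) ≤ L := by exact_mod_cast hL1
  set B : ℝ := 1 + ∑ i, β i with hBdef
  have hsum0 : 0 ≤ ∑ i, β i := Finset.sum_nonneg fun i _ => (hβ i).le
  have hB0 : 0 < B := by positivity
  have hB : ∀ i, β i ≤ B := fun i => by
    have := Finset.single_le_sum (fun i _ => (hβ i).le) (Finset.mem_univ i) (f := β)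
    linarith
  have hlog2 : 0 < Real.log 2 := Real.log_pos (by norm_num)
  have hlogL : 0 ≤ Real.log L := Real.log_nonneg hL1'
  -- `K` may not depend on `α`, although `n₀` does. When a bad edge exists, `n ≥ 3` and `(log n / n)
  -- |T| ≥ ω log 2 / B`, so this constant pays for at most `L` containers at every such `n`.
  set K₂ : ℝ := Real.log L * B / (ω * Real.log 2) with hK₂
  have hK₂0 : 0 ≤ K₂ := by positivity
  refine ⟨7 * L + K₂, by positivity, fun α hα _ => ?_⟩
  obtain ⟨ε, n₀, hε, hlarge⟩ := ColoredChains.exists_containers_of_large h2 hsparse hβ hω hα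
  -- For `n < n₀` the size of `T` is at most `m * 2 ^ n₀`, so removing one pair is already a loss of
  -- this proportion.
  refine ⟨min ε (1 / (m * 2 ^ n₀ + 1)), by positivity, fun n T hmid hw => ?_⟩
  have hT : ∀ x ∈ T.supp, n ≤ 3 * x.card ∧ 3 * x.card ≤ 2 * n := by
    intro x hx
    obtain ⟨h1, h3⟩ := hmid x hx
    constructor
    · have : (n : ℝ) ≤ 3 * x.card := by linarith
      exact_mod_cast this
    · have : (3 : ℝ) * x.card ≤ 2 * n := by linarith
      exact_mod_cast this
  have hlog0 : 0 ≤ Real.log n / n := div_nonneg (Real.log_natCast_nonneg n) (Nat.cast_nonneg n)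
  rcases le_or_gt n₀ n with hn | hn
  · obtain ⟨𝒟, hcard, hsub, hcover⟩ := hlarge n T hn hT hw
    refine ColoredChains.exists_templates_of_containers 𝒟 (hcard.trans (Real.exp_le_exp.2 ?_))
      (fun D hD => ⟨(hsub D hD).1, (hsub D hD).2.trans ?_⟩) hcover
    · gcongr
      linarith
    · gcongr
      exact min_le_left _ _
  · have hN0 : (0 : ℝ) < n.choose (n / 2) := by
      exact_mod_cast Nat.choose_pos (Nat.div_le_self n 2)
    obtain ⟨w, -, hwT, -⟩ := ColoredChains.exists_spread_weight h2 hsparse hβ hB hB0.le T hT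
    -- Without bad edges, supersaturation would bound the weight of `T` by `ω` times the middle
    -- binomial coefficient.
    obtain ⟨A, hA⟩ : (T.badEdges 𝒢).Nonempty := by
      by_contra h
      rw [Finset.not_nonempty_iff_eq_empty.1 h, Finset.sum_empty, mul_zero, add_zero] at hwT
      nlinarith
    have hn3 := ColoredChains.three_le_of_mem_badEdges h2 hT hA
    have hAT := (ColoredChains.Template.mem_badEdges.1 hA).1
    have hn0 : (0 : ℝ) < n := by exact_mod_cast (by omega : 0 < n)
    have hAL := ColoredChains.Template.card_le_of_mem_badEdges hA
    refine ColoredChains.exists_templates_of_containers (A.image fun v => T.pairs.erase v)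
      ?_ (fun D hD => ?_) fun I hI hind => ?_
    · have h1 : ((A.image fun v => T.pairs.erase v).card : ℝ) ≤ L := by
        exact_mod_cast Finset.card_image_le.trans hAL
      refine h1.trans ?_
      rw [← Real.log_le_iff_le_exp (by positivity)]
      have hsize : ω * n ≤ B * T.size := by
        have h3 := T.weight_le hβ hB
        have h4 : (n : ℝ) ≤ n.choose (n / 2) := by
          exact_mod_cast (Nat.choose_one_right n).symm.trans_le (Nat.choose_le_middle 1 n)
        nlinarith
      have hlogn : Real.log 2 ≤ Real.log n :=
        Real.log_le_log (by norm_num) (by exact_mod_cast (by omega : 2 ≤ n))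
      have h5 : ω * Real.log 2 / B ≤ Real.log n / n * T.size := by
        rw [div_le_iff₀ hB0, div_mul_eq_mul_div, div_mul_eq_mul_div, le_div_iff₀ hn0]
        calc ω * Real.log 2 * n = Real.log 2 * (ω * n) := by ring
          _ ≤ Real.log n * (B * T.size) := by gcongr
          _ = _ := by ring
      calc Real.log L = K₂ * (ω * Real.log 2 / B) := by rw [hK₂]; field_simp
        _ ≤ K₂ * (Real.log n / n * T.size) := by gcongr
        _ ≤ (7 * L + K₂) * (Real.log n / n * T.size) := by
            gcongr
            linarith
        _ = _ := by ring
    · obtain ⟨v, hv, rfl⟩ := Finset.mem_image.1 hD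
      refine ⟨Finset.erase_subset _ _, ?_⟩
      have h1 := Finset.card_erase_add_one (hAT hv)
      rw [T.card_pairs] at h1
      have h3 : ((T.pairs.erase v).card : ℝ) + 1 = T.size := by exact_mod_cast h1
      have h4 : (T.size : ℝ) ≤ m * 2 ^ n₀ := by
        have h5 := T.size_le.trans (Nat.mul_le_mul_left m (Nat.pow_le_pow_right two_pos hn.le))
        exact_mod_cast h5
      have h6 : min ε (1 / (m * 2 ^ n₀ + 1)) * T.size ≤ 1 := by
        calc _ ≤ 1 / ((m : ℝ) * 2 ^ n₀ + 1) * T.size := by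
              gcongr
              exact min_le_right _ _
          _ ≤ 1 := by
              rw [div_mul_eq_mul_div, one_mul, div_le_one (by positivity)]
              linarith
      linarith
    · obtain ⟨v, hv, hvI⟩ := Finset.not_subset.1 (hind A hA)
      exact ⟨_, Finset.mem_image_of_mem _ hv, fun u hu =>
        Finset.mem_erase.2 ⟨fun h => hvI (h ▸ hu), hI hu⟩⟩
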